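/- **Theorem 3.8.** Let $P\in\mathbb{R}^3\setminus\{0\}$, let $\mu_+,\mu_-\ge 0$ with $\mu_++\mu_-=1$, and let $$T(\eta)=T_{P,0,\mu_\pm}(\eta)=|\mu_+P-\eta|+|\mu_-P+\eta|-|P|\ \ (\ge 0),\qquad \eta\in\mathbb{R}^3,$$ be the kinetic energy symbol of the ultra-relativistic pair operator with total momentum $P$. Let $T(q)$, $q=-i\nabla$, be the corresponding Fourier multiplier on $L^2(\mathbb{R}^3)$. Let $V:\mathbb{R}^3\to\mathbb{R}$ be a measurable potential which is not almost everywhere zero and which is relatively form compact with respect to $T(q)$, i.e. $(T(q)+1)^{-1/2}|V|(T(q)+1)^{-1/2}$ is a compact operator on $L^2(\mathbb{R}^3)$. Assume that the positive part of $V$ is integrable and that $\int_{\mathbb{R}^3}V\,dx\le 0$, where the value $-\infty$ is allowed. Let $T(q)+V$ be the operator on $L^2(\mathbb{R}^3)$ defined as a form sum, i.e. the operator associated with the quadratic form $\langle\psi,T(q)\psi\rangle+\langle\psi,V\psi\rangle$ on the form domain of $T(q)$. Then $T(q)+V$ has at least one strictly negative eigenvalue. If, in addition, $V\le 0$ almost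 everywhere, then $T(q)+V$ has infinitely many (distinct) strictly negative eigenvalues. -/

import Mathlib

open MeasureTheory
open scoped ENNReal FourierTransform ComplexConjugate InnerProductSpace

noncomputable section

namespace PairOperator

/-- Configuration space `ℝ³`, also used as momentum space. -/
abbrev R3 : Type := EuclideanSpace ℝ (Fin 3)

/-- The Hilbert space `L²(ℝ³; ℂ)`. -/
abbrev L2 : Type := Lp (α := R3) ℂ 2 volume

/-- A kinetic energy symbol: a measurable function `T : ℝ³ → [0, ∞)`. -/
structure KineticSymbol where
  toFun : R3 → ℝ
  measurable' : Measurable toFun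
  nonneg' : ∀ η, 0 ≤ toFun η

/-- The symbol `η ↦ |μ₊P - η| + |μ₋P + η| - |P|` of the ultra-relativistic pair operator with
total momentum `P`. -/
def pairSymbol (P : R3) (μp μm : ℝ) (hμ : μp + μm = 1) : KineticSymbol where
  toFun η := ‖μp • P - η‖ + ‖μm • P + η‖ - ‖P‖
  measurable' := by fun_prop
  nonneg' η := by
    have h := norm_add_le (μp • P - η) (μm • P + η)
    have e : (μp • P - η) + (μm • P + η) = P := by
      have : (μp • P - η) + (μm • P + η) = (μp + μm) • P := by rw [add_smul]; abel
      rw [this, hμ, one_smul]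
    rw [e] at h
    linarith

/-- The symbol in the frequency variable `ξ` of Mathlib's Fourier transform, whose kernel is
`exp (-2πi ξ·x)`: the momentum `p = -i∇` acts as multiplication by `2πξ`, so that
`T(p) φ = 𝓕⁻¹ [T(2πξ) (𝓕 φ)(ξ)]`. -/
def KineticSymbol.freq (T : KineticSymbol) (ξ : R3) : ℝ := T.toFun ((2 * Real.pi) • ξ)

lemma KineticSymbol.measurable_freq (T : KineticSymbol) : Measurable T.freq :=
  T.measurable'.comp (measurable_const_smul _)

lemma KineticSymbol.freq_nonneg (T : KineticSymbol) (ξ : R3) : 0 ≤ T.freq ξ := T.nonneg' _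

/-- Multiplication by an essentially bounded function, as a bounded operator on `L²`. -/
def mulOp (m : R3 → ℂ) (hm : MemLp m ∞ volume) : L2 →L[ℂ] L2 :=
  (ContinuousLinearMap.mul ℂ ℂ).holderL volume ∞ 2 2 (hm.toLp m)

lemma KineticSymbol.memLp_invSqrt (T : KineticSymbol) :
    MemLp (fun ξ => (((√(T.freq ξ + 1))⁻¹ : ℝ) : ℂ)) ∞ (volume : Measure R3) := by
  have hmeas : Measurable (fun ξ => (((√(T.freq ξ + 1))⁻¹ : ℝ) : ℂ)) := by
    have := T.measurable_freq
    fun_prop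
  refine memLp_top_of_bound hmeas.aestronglyMeasurable 1 (Filter.Eventually.of_forall fun ξ => ?_)
  have h1 : 1 ≤ √(T.freq ξ + 1) := by
    rw [Real.one_le_sqrt]
    linarith [T.freq_nonneg ξ]
  rw [Complex.norm_real, Real.norm_of_nonneg (by positivity)]
  exact inv_le_one_of_one_le₀ h1

/-- The bounded operator `(T(p) + 1)^{-1/2}` on `L²(ℝ³)`. -/
def invSqrtOp (T : KineticSymbol) : L2 →L[ℂ] L2 :=
  ((Lp.fourierTransformₗᵢ R3 ℂ).symm : L2 →L[ℂ] L2) ∘L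
    mulOp (fun ξ => (((√(T.freq ξ + 1))⁻¹ : ℝ) : ℂ)) T.memLp_invSqrt ∘L
      ((Lp.fourierTransformₗᵢ R3 ℂ) : L2 →L[ℂ] L2)

/-- `V` is relatively form compact with respect to `T(p)`: the operator
`(T(p) + 1)^{-1/2} |V| (T(p) + 1)^{-1/2}`, understood through its sesquilinear form, is (everywhere
defined and) a compact operator on `L²(ℝ³)`. -/
def RelFormCompact (T : KineticSymbol) (V : R3 → ℝ) : Prop :=
  ∃ K : L2 →L[ℂ] L2, IsCompactOperator K ∧ ∀ f g : L2,
    Integrable (fun x => ((|V x| : ℝ) : ℂ) * (conj (invSqrtOp T f x) * invSqrtOp T g x)) volume ∧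
    ∫ x, ((|V x| : ℝ) : ℂ) * (conj (invSqrtOp T f x) * invSqrtOp T g x) = ⟪f, K g⟫_ℂ

/-- The domain of multiplication by `|w|^{1/2}`: all `f ∈ L²` with `∫ |w| |f|² < ∞`. -/
def weightDomain (w : R3 → ℝ) : Submodule ℂ L2 where
  carrier := {f | MemLp (fun x => ((√|w x| : ℝ) : ℂ) * f x) 2 volume}
  zero_mem' := by
    refine (MemLp.zero (ε := ℂ)).ae_eq ?_
    filter_upwards [Lp.coeFn_zero ℂ 2 (volume : Measure R3)] with x hx
    rw [hx]
    simp only [Pi.zero_apply, mul_zero]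
  add_mem' := by
    intro f g hf hg
    refine (MemLp.add hf hg).ae_eq ?_
    filter_upwards [Lp.coeFn_add f g] with x hx
    rw [hx]
    simp only [Pi.add_apply, mul_add]
  smul_mem' := by
    intro c f hf
    refine (MemLp.const_mul hf c).ae_eq ?_
    filter_upwards [Lp.coeFn_smul c f] with x hx
    rw [hx]
    simp only [Pi.smul_apply, smul_eq_mul, mul_left_comm]

lemma integrable_of_mem_weightDomain {w : R3 → ℝ} (hw : AEMeasurable w volume) {f g : L2}
    (hf : f ∈ weightDomain w) (hg : g ∈ weightDomain w) :
    Integrable (fun x => (w x : ℂ) * (conj (f x) * g x)) volume := by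
  have h : Integrable (fun x => (((√|w x| : ℝ) : ℂ) * f x) * (((√|w x| : ℝ) : ℂ) * g x)) volume :=
    MemLp.integrable_mul hf hg
  have hw' : AEMeasurable (fun x => (w x : ℂ)) volume := by fun_prop
  have hf' : AEMeasurable (fun x => conj (f x)) volume := by
    have := (Lp.aestronglyMeasurable f).aemeasurable
    fun_prop
  have hg' : AEMeasurable (fun x => g x) volume := (Lp.aestronglyMeasurable g).aemeasurable
  refine h.mono (hw'.mul (hf'.mul hg')).aestronglyMeasurable (Filter.Eventually.of_forall fun x => ?_)
  have hs : √|w x| * √|w x| = |w x| := Real.mul_self_sqrt (abs_nonneg _)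
  simp only [norm_mul, Complex.norm_real, Real.norm_eq_abs, RCLike.norm_conj,
    abs_of_nonneg (Real.sqrt_nonneg _)]
  apply le_of_eq
  calc |w x| * (‖f x‖ * ‖g x‖) = √|w x| * √|w x| * (‖f x‖ * ‖g x‖) := by rw [hs]
    _ = √|w x| * ‖f x‖ * (√|w x| * ‖g x‖) := by ring

/-- The form domain `Q(T(p)) = {ψ ∈ L² : ∫ T |ψ̂|² < ∞}` of the kinetic energy. -/
def kineticFormDomain (T : KineticSymbol) : Submodule ℂ L2 :=
  (weightDomain T.freq).comap
    ((Lp.fourierTransformₗᵢ R3 ℂ).toLinearEquiv : L2 →ₗ[ℂ] L2)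

lemma mem_kineticFormDomain {T : KineticSymbol} {f : L2} :
    f ∈ kineticFormDomain T ↔ (𝓕 f : L2) ∈ weightDomain T.freq := Iff.rfl

/-- The domain `Q(T(p)) ∩ Q(V)` of the form sum. It is `Q(T(p))` if `V` is relatively form compact
with respect to `T(p)`. -/
def sumFormDomain (T : KineticSymbol) (V : R3 → ℝ) : Submodule ℂ L2 :=
  kineticFormDomain T ⊓ weightDomain V

/-- The sesquilinear form `⟨φ, T(p) ψ⟩ + ⟨φ, V ψ⟩`. -/
def sumForm (T : KineticSymbol) (V : R3 → ℝ) (φ ψ : L2) : ℂ :=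
  (∫ ξ, (T.freq ξ : ℂ) * (conj ((𝓕 φ : L2) ξ) * (𝓕 ψ : L2) ξ)) +
    ∫ x, (V x : ℂ) * (conj (φ x) * ψ x)

/-- The sesquilinear form of `T(p) + V` is additive in its second argument. -/
lemma sumForm_add_right {T : KineticSymbol} {V : R3 → ℝ} (hV : AEMeasurable V volume)
    {φ ψ χ : L2} (hφ : φ ∈ sumFormDomain T V) (hψ : ψ ∈ sumFormDomain T V)
    (hχ : χ ∈ sumFormDomain T V) :
    sumForm T V φ (ψ + χ) = sumForm T V φ ψ + sumForm T V φ χ := by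
  have hT : AEMeasurable T.freq (volume : Measure R3) := T.measurable_freq.aemeasurable
  have h1 := integral_add (integrable_of_mem_weightDomain hT hφ.1 hψ.1)
    (integrable_of_mem_weightDomain hT hφ.1 hχ.1)
  have h2 := integral_add (integrable_of_mem_weightDomain hV hφ.2 hψ.2)
    (integrable_of_mem_weightDomain hV hφ.2 hχ.2)
  have e1 : (∫ ξ, (T.freq ξ : ℂ) * (conj ((𝓕 φ : L2) ξ) * (𝓕 (ψ + χ) : L2) ξ)) =
      ∫ ξ, ((T.freq ξ : ℂ) * (conj ((𝓕 φ : L2) ξ) * (𝓕 ψ : L2) ξ) +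
        (T.freq ξ : ℂ) * (conj ((𝓕 φ : L2) ξ) * (𝓕 χ : L2) ξ)) := by
    refine integral_congr_ae ?_
    rw [FourierTransform.fourier_add]
    filter_upwards [Lp.coeFn_add (𝓕 ψ : L2) (𝓕 χ : L2)] with x hx
    rw [hx, Pi.add_apply]; ring
  have e2 : (∫ x, (V x : ℂ) * (conj (φ x) * (ψ + χ : L2) x)) =
      ∫ x, ((V x : ℂ) * (conj (φ x) * ψ x) + (V x : ℂ) * (conj (φ x) * χ x)) := by
    refine integral_congr_ae ?_
    filter_upwards [Lp.coeFn_add ψ χ] with x hx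
    rw [hx, Pi.add_apply]; ring
  have h1' := e1.trans h1
  have h2' := e2.trans h2
  change _ + _ = _
  rw [h1', h2']
  change _ = (_ + _) + (_ + _)
  exact add_add_add_comm _ _ _ _

lemma sumForm_smul_right (T : KineticSymbol) (V : R3 → ℝ) (c : ℂ) (φ ψ : L2) :
    sumForm T V φ (c • ψ) = c * sumForm T V φ ψ := by
  unfold sumForm
  rw [mul_add, ← integral_const_mul, ← integral_const_mul, FourierTransform.fourier_smul]
  congr 1
  · refine integral_congr_ae ?_
    filter_upwards [Lp.coeFn_smul c (𝓕 ψ : L2)] with x hx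
    rw [hx, Pi.smul_apply, smul_eq_mul]; ring
  · refine integral_congr_ae ?_
    filter_upwards [Lp.coeFn_smul c ψ] with x hx
    rw [hx, Pi.smul_apply, smul_eq_mul]; ring

/-- The graph of the operator associated with the form of `T(p) + V`: the pairs `(ψ, χ)` such that
`ψ` is in the form domain and `⟨φ, T(p) ψ⟩ + ⟨φ, V ψ⟩ = ⟨φ, χ⟩` for all `φ` in the form domain. -/
def formGraph (T : KineticSymbol) (V : R3 → ℝ) (hV : AEMeasurable V volume) :
    Submodule ℂ (L2 × L2) where
  carrier := {z | z.1 ∈ sumFormDomain T V ∧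
    ∀ φ ∈ sumFormDomain T V, sumForm T V φ z.1 = ⟪φ, z.2⟫_ℂ}
  zero_mem' := by
    refine ⟨zero_mem _, fun φ _ => ?_⟩
    have := sumForm_smul_right T V 0 φ 0
    simpa using this
  add_mem' := by
    rintro a b ⟨ha, ha'⟩ ⟨hb, hb'⟩
    refine ⟨add_mem ha hb, fun φ hφ => ?_⟩
    rw [Prod.fst_add, Prod.snd_add, sumForm_add_right hV hφ ha hb, ha' φ hφ, hb' φ hφ,
      inner_add_right]
  smul_mem' := by
    rintro c a ⟨ha, ha'⟩
    refine ⟨Submodule.smul_mem _ c ha, fun φ hφ => ?_⟩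
    rw [Prod.smul_fst, Prod.smul_snd, sumForm_smul_right, ha' φ hφ, inner_smul_right]

/-- The operator `T(p) + V` on `L²(ℝ³)`, defined as a form sum: the operator whose graph is
`formGraph T V hV`, which is the graph of a function by `formGraph_single_valued`
whenever `V` is relatively form compact with respect to `T(p)`. -/
def formSum (T : KineticSymbol) (V : R3 → ℝ) (hV : AEMeasurable V volume) : L2 →ₗ.[ℂ] L2 :=
  (formGraph T V hV).toLinearPMap

/-- `E` is an eigenvalue of the (unbounded) operator `H`. -/
def IsEigenvalue (H : L2 →ₗ.[ℂ] L2) (E : ℝ) : Prop :=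
  ∃ ψ : H.domain, (ψ : L2) ≠ 0 ∧ H ψ = (E : ℂ) • (ψ : L2)

lemma fourier_invSqrtOp (T : KineticSymbol) (f : L2) :
    (𝓕 (invSqrtOp T f) : L2) =ᵐ[volume]
      fun ξ => (((√(T.freq ξ + 1))⁻¹ : ℝ) : ℂ) * (𝓕 f : L2) ξ := by
  have h : (𝓕 (invSqrtOp T f) : L2) = (ContinuousLinearMap.mul ℂ ℂ).holder 2
      (T.memLp_invSqrt.toLp _) (𝓕 f : L2) :=
    (Lp.fourierTransformₗᵢ R3 ℂ).apply_symm_apply _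
  rw [h]
  filter_upwards [(ContinuousLinearMap.mul ℂ ℂ).coeFn_holder (r := 2)
    (T.memLp_invSqrt.toLp _) (𝓕 f : L2), T.memLp_invSqrt.coeFn_toLp] with ξ h1 h2
  rw [h1, h2]
  rfl

/-- The range of `(T(p) + 1)^{-1/2}` is contained in the form domain of `T(p) + V`. -/
lemma invSqrtOp_mem {T : KineticSymbol} {V : R3 → ℝ} (hV : AEMeasurable V volume)
    (hc : RelFormCompact T V) (f : L2) : invSqrtOp T f ∈ sumFormDomain T V := by
  refine ⟨?_, ?_⟩
  · rw [SetLike.mem_coe, mem_kineticFormDomain]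
    have hmeas : AEStronglyMeasurable (fun ξ => ((√|T.freq ξ| : ℝ) : ℂ) *
        (𝓕 (invSqrtOp T f) : L2) ξ) volume := by
      have h0 : Measurable (fun ξ => ((√|T.freq ξ| : ℝ) : ℂ)) := by
        have := T.measurable_freq
        have h' : Measurable (fun ξ => |T.freq ξ|) := this.abs
        fun_prop
      exact h0.aestronglyMeasurable.mul (Lp.aestronglyMeasurable _)
    refine (Lp.memLp (𝓕 f : L2)).mono hmeas ?_
    filter_upwards [fourier_invSqrtOp T f] with ξ hξ
    have hT := T.freq_nonneg ξ
    rw [hξ, ← mul_assoc, norm_mul, norm_mul, Complex.norm_real, Complex.norm_real,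
      Real.norm_of_nonneg (Real.sqrt_nonneg _), Real.norm_of_nonneg (by positivity),
      abs_of_nonneg hT]
    refine mul_le_of_le_one_left (norm_nonneg _) ?_
    rw [← div_eq_mul_inv]
    exact div_le_one_of_le₀ (Real.sqrt_le_sqrt (by linarith)) (Real.sqrt_nonneg _)
  · obtain ⟨K, -, hK⟩ := hc
    have hi := (hK f f).1
    change MemLp (fun x => ((√|V x| : ℝ) : ℂ) * invSqrtOp T f x) 2 volume
    have hmeas : AEStronglyMeasurable (fun x => ((√|V x| : ℝ) : ℂ) * invSqrtOp T f x) volume := by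
      have h0 : AEMeasurable (fun x => ((√|V x| : ℝ) : ℂ)) volume := by
        have h' : AEMeasurable (fun x => |V x|) volume := hV.abs
        fun_prop
      exact h0.aestronglyMeasurable.mul (Lp.aestronglyMeasurable _)
    rw [memLp_two_iff_integrable_sq_norm hmeas]
    refine hi.norm.congr (Filter.Eventually.of_forall fun x => ?_)
    simp only [norm_mul, Complex.norm_real, Real.norm_eq_abs, RCLike.norm_conj, abs_abs,
      mul_pow, sq_abs, Real.sq_sqrt (abs_nonneg (V x))]
    ring

/-- The operator `T(p) + V` is well defined: its graph is the graph of a function. -/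
lemma formGraph_single_valued {T : KineticSymbol} {V : R3 → ℝ} (hV : AEMeasurable V volume)
    (hc : RelFormCompact T V) :
    ∀ z ∈ formGraph T V hV, z.1 = 0 → z.2 = 0 := by
  rintro ⟨ψ, χ⟩ ⟨-, h⟩ (rfl : ψ = 0)
  have h0 : ⟪invSqrtOp T χ, χ⟫_ℂ = 0 := by
    rw [← h _ (invSqrtOp_mem hV hc χ)]
    have := sumForm_smul_right T V 0 (invSqrtOp T χ) 0
    simpa using this
  rw [← Lp.inner_fourier_eq, L2.inner_def] at h0
  have hpos : ∀ ξ, 0 < (√(T.freq ξ + 1))⁻¹ := fun ξ => by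
    have := T.freq_nonneg ξ
    positivity
  have hre : (fun ξ => ⟪(𝓕 (invSqrtOp T χ) : L2) ξ, (𝓕 χ : L2) ξ⟫_ℂ) =ᵐ[volume]
      fun ξ => (((√(T.freq ξ + 1))⁻¹ * ‖(𝓕 χ : L2) ξ‖ ^ 2 : ℝ) : ℂ) := by
    filter_upwards [fourier_invSqrtOp T χ] with ξ hξ
    rw [hξ, RCLike.inner_apply, map_mul, Complex.conj_ofReal, mul_left_comm, Complex.mul_conj']
    push_cast
    ring
  have hint := (L2.integrable_inner (𝕜 := ℂ) (𝓕 (invSqrtOp T χ) : L2) (𝓕 χ : L2)).congr hre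
  rw [integral_congr_ae hre, integral_complex_ofReal, Complex.ofReal_eq_zero,
    integral_eq_zero_iff_of_nonneg (fun ξ => mul_nonneg (hpos ξ).le (sq_nonneg _))
      ((hint.re).congr (Filter.Eventually.of_forall fun ξ => Complex.ofReal_re _))] at h0
  have hF : (𝓕 χ : L2) = 0 := by
    rw [Lp.eq_zero_iff_ae_eq_zero]
    filter_upwards [h0] with ξ hξ
    have := (mul_eq_zero.1 hξ).resolve_left (hpos ξ).ne'
    simpa using this
  have hn : ‖χ‖ = 0 := by rw [← Lp.norm_fourier_eq, hF, norm_zero]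
  exact norm_eq_zero.1 hn

end PairOperator

end

/-! The kinetic symbol vanishes on the segment of momenta `s • P`, `-μm ≤ s ≤ μp`, and only
quadratically in the two directions transversal to `P` (`pairSymbol_freq_le`). In two transversal
dimensions the inverse square distance diverges logarithmically, so the inverse symbol is not
integrable near any point of the segment (`lintegral_inv_pairSymbol_eq_top`). Hence every plane wave
with momentum on the segment is a bounded pointwise limit of form-domain states whose kinetic energy
tends to zero (`exists_trialState`): it costs no kinetic energy.

Suppose the form of `T + V` were nonnegative. Momentum zero lies on the segment, so there are trial
states tending to `1`, and Fatou's lemma bounds the integral of the negative part of `V` by that of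
the positive part. Thus `V` is integrable with integral zero. Replacing `1` by `1 + t g` leaves `0 ≤
2 t ∫ V g + O(t²)`, so `∫ V g = 0` for every test function `g` and `V = 0` (`exists_sumForm_neg`).
If `V ≤ 0`, the same argument runs on the span of `N` plane waves: if the form is not negative
definite on the trial spaces, a limit combination `u` of plane waves satisfies `∫ |V| |u|² = 0`,
although `u` is nonzero almost everywhere (`exists_sumForm_neg_of_nonpos`).

Negative form values become eigenvalues through `R = (T + 1)^{-1/2}` and the compact operator `B = R
V R`: the pencil `1 - (1 + E) R² + B` is formally `R (T + V - E) R`, and its kernel vectors `f` give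
eigenvectors `R f`. For `E < 0` it is a compact perturbation of an operator bounded below, so
approximate null vectors have limits, and the largest `E` with a nonnegative pencil is an eigenvalue
(`exists_pencil_eq_zero`). Were there only finitely many negative eigenvalues, a finite-rank penalty
on their eigenspaces would lift them away while the form stays negative somewhere; this produces a
new eigenvector orthogonal to all the old ones, a contradiction (`infinite_setOf_pencil_eq_zero`).
-/

/-! ### Kernels of an abstract self-adjoint pencil. -/

section Pencil

open Filter Topology

namespace PairOperator

variable {H : Type*} [NormedAddCommGroup H] [InnerProductSpace ℂ H]

/-- `B` maps bounded sequences to sequences with convergent subsequences. -/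
def SeqCompactOp (B : H → H) : Prop :=
  ∀ (f : ℕ → H) (r : ℝ), (∀ n, ‖f n‖ ≤ r) →
    ∃ (y : H) (φ : ℕ → ℕ), StrictMono φ ∧ Tendsto (fun n => B (f (φ n))) atTop (𝓝 y)

lemma SeqCompactOp.of_isCompactOperator {B : H →L[ℂ] H} (hB : IsCompactOperator B) :
    SeqCompactOp B := by
  intro f r hf
  obtain ⟨K, hK, hsub⟩ := IsCompactOperator.image_closedBall_subset_compact
    (f := (B : H →ₗ[ℂ] H)) hB r
  obtain ⟨y, -, φ, hφ, h⟩ := hK.tendsto_subseq (x := fun n => B (f n))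
    (fun n => hsub ⟨f n, by simpa using hf n, rfl⟩)
  exact ⟨y, φ, hφ, h⟩

omit [InnerProductSpace ℂ H] in
lemma SeqCompactOp.add {B C : H → H} (hB : SeqCompactOp B) (hC : SeqCompactOp C) :
    SeqCompactOp (fun f => B f + C f) := by
  intro f r hf
  obtain ⟨y, φ, hφ, hy⟩ := hB f r hf
  obtain ⟨z, ρ, hρ, hz⟩ := hC (f ∘ φ) r (fun n => hf _)
  exact ⟨y + z, φ ∘ ρ, hφ.comp hρ, (hy.comp hρ.tendsto_atTop).add hz⟩

/-- The operator pencil `1 - (1 + E) R² + B`. For `R = (T + 1)^{-1/2}` and `B = R V R` it is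
`R (T + V - E) R`. -/
noncomputable def pencil (R B : H →L[ℂ] H) (E : ℝ) : H →L[ℂ] H :=
  ContinuousLinearMap.id ℂ H - ((1 + E : ℝ) : ℂ) • (R ∘L R) + B

lemma pencil_apply (R B : H →L[ℂ] H) (E : ℝ) (f : H) :
    pencil R B E f = f - ((1 + E : ℝ) : ℂ) • R (R f) + B f := rfl

variable {R B : H →L[ℂ] H}

/-- Symmetry of `R` turns `⟪f, R² f⟫` into `‖R f‖²`: the form is affine and nonincreasing in `E`,
with slope `-‖R f‖²`. -/
lemma re_inner_pencil (hR : ∀ f g, ⟪R f, g⟫_ℂ = ⟪f, R g⟫_ℂ) (E : ℝ) (f : H) :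
    (⟪f, pencil R B E f⟫_ℂ).re = ‖f‖ ^ 2 - (1 + E) * ‖R f‖ ^ 2 + (⟪f, B f⟫_ℂ).re := by
  rw [pencil_apply, inner_add_right, inner_sub_right, inner_smul_right, ← hR,
    inner_self_eq_norm_sq_to_K, inner_self_eq_norm_sq_to_K]
  simp only [Complex.add_re, Complex.sub_re, Complex.re_ofReal_mul]
  norm_cast

lemma inner_pencil_left (hR : ∀ f g, ⟪R f, g⟫_ℂ = ⟪f, R g⟫_ℂ)
    (hB : ∀ f g, ⟪B f, g⟫_ℂ = ⟪f, B g⟫_ℂ) (E : ℝ) (f g : H) :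
    ⟪pencil R B E f, g⟫_ℂ = ⟪f, pencil R B E g⟫_ℂ := by
  simp only [pencil_apply, inner_add_right, inner_sub_right, inner_smul_right, inner_add_left,
    inner_sub_left, inner_smul_left, hR, hB, Complex.conj_ofReal]

/-- A positive symmetric operator satisfies `‖A f‖² ≤ ‖A‖ ⟨f, A f⟩`. -/
lemma norm_sq_apply_le_of_nonneg {A : H →L[ℂ] H} (hA : ∀ f g, ⟪A f, g⟫_ℂ = ⟪f, A g⟫_ℂ)
    (hpos : ∀ f, 0 ≤ (⟪f, A f⟫_ℂ).re) {M : ℝ} (hM : 0 < M) (hAM : ‖A‖ ≤ M) (f : H) :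
    ‖A f‖ ^ 2 ≤ M * (⟪f, A f⟫_ℂ).re := by
  -- Expanding this gives `⟪f, A f⟫ ≥ 2 M⁻¹ ‖A f‖² - M⁻² ⟪A f, A² f⟫`, and the last term is at most
  -- `M⁻¹ ‖A f‖²`.
  have key := hpos (f - ((M⁻¹ : ℝ) : ℂ) • A f)
  have hself : ⟪A f, A f⟫_ℂ = ((‖A f‖ ^ 2 : ℝ) : ℂ) := by
    rw [inner_self_eq_norm_sq_to_K]; norm_cast
  have h2 : (⟪A f, A (A f)⟫_ℂ).re ≤ M * ‖A f‖ ^ 2 := by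
    calc (⟪A f, A (A f)⟫_ℂ).re ≤ ‖⟪A f, A (A f)⟫_ℂ‖ := Complex.re_le_norm _
      _ ≤ ‖A f‖ * ‖A (A f)‖ := norm_inner_le_norm _ _
      _ ≤ ‖A f‖ * (M * ‖A f‖) := by
          gcongr
          exact (A.le_opNorm _).trans (by gcongr)
      _ = _ := by ring
  have e : (⟪f - ((M⁻¹ : ℝ) : ℂ) • A f, A (f - ((M⁻¹ : ℝ) : ℂ) • A f)⟫_ℂ).re =
      (⟪f, A f⟫_ℂ).re - 2 * M⁻¹ * ‖A f‖ ^ 2 + M⁻¹ ^ 2 * (⟪A f, A (A f)⟫_ℂ).re := by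
    rw [map_sub, map_smul, inner_sub_left, inner_sub_right, inner_sub_right, inner_smul_left,
      inner_smul_left, inner_smul_right, inner_smul_right, ← hA f (A f), hself,
      Complex.conj_ofReal]
    simp only [Complex.sub_re, Complex.re_ofReal_mul, Complex.ofReal_re]
    ring
  rw [e] at key
  have h3 : M⁻¹ ^ 2 * (⟪A f, A (A f)⟫_ℂ).re ≤ M⁻¹ ^ 2 * (M * ‖A f‖ ^ 2) := by gcongr
  have h4 : M⁻¹ ^ 2 * (M * ‖A f‖ ^ 2) = M⁻¹ * ‖A f‖ ^ 2 := by field_simp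
  have h5 : M⁻¹ * ‖A f‖ ^ 2 ≤ (⟪f, A f⟫_ℂ).re := by linarith
  calc ‖A f‖ ^ 2 = M * (M⁻¹ * ‖A f‖ ^ 2) := by field_simp
    _ ≤ _ := by gcongr

/-- For `E < 0`, `1 - (1 + E) R²` is bounded below. -/
lemma exists_le_norm_pencil_zero (hR : ∀ f g, ⟪R f, g⟫_ℂ = ⟪f, R g⟫_ℂ) (hR1 : ∀ f, ‖R f‖ ≤ ‖f‖)
    {E : ℝ} (hE : E < 0) : ∃ c > 0, ∀ f : H, c * ‖f‖ ≤ ‖pencil R 0 E f‖ := by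
  -- If `1 + E ≤ 0` the `R` term helps and the form is at least `‖f‖²`; otherwise `‖R f‖ ≤ ‖f‖`
  -- leaves `-E ‖f‖²`.
  refine ⟨min 1 (-E), lt_min one_pos (by linarith), fun f => ?_⟩
  have h1 := re_inner_pencil (B := 0) hR E f
  simp only [zero_apply, inner_zero_right, Complex.zero_re, add_zero] at h1
  have hsq : ‖R f‖ ^ 2 ≤ ‖f‖ ^ 2 := by gcongr; exact hR1 f
  have h2 : min 1 (-E) * ‖f‖ ^ 2 ≤ ‖f‖ ^ 2 - (1 + E) * ‖R f‖ ^ 2 := by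
    rcases le_total (1 + E) 0 with h | h
    · have : min 1 (-E) ≤ 1 := min_le_left _ _
      nlinarith [sq_nonneg ‖f‖, sq_nonneg ‖R f‖]
    · have : min 1 (-E) ≤ -E := min_le_right _ _
      nlinarith [sq_nonneg ‖f‖, sq_nonneg ‖R f‖]
  have h3 : (⟪f, pencil R 0 E f⟫_ℂ).re ≤ ‖f‖ * ‖pencil R 0 E f‖ :=
    (Complex.re_le_norm _).trans (norm_inner_le_norm _ _)
  rcases (norm_nonneg f).eq_or_lt with h0 | h0
  · rw [← h0, mul_zero]; exact norm_nonneg _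
  · refine le_of_mul_le_mul_left ?_ h0
    nlinarith

/-- Approximate null sequences of the pencil have convergent subsequences. -/
lemma exists_subseq_tendsto_of_pencil_tendsto [CompleteSpace H]
    (hR : ∀ f g, ⟪R f, g⟫_ℂ = ⟪f, R g⟫_ℂ) (hR1 : ∀ f, ‖R f‖ ≤ ‖f‖)
    (hBc : SeqCompactOp B) {E : ℝ} (hE : E < 0) {f : ℕ → H} {r : ℝ} (hf : ∀ n, ‖f n‖ ≤ r)
    (h0 : Tendsto (fun n => pencil R B E (f n)) atTop (𝓝 0)) :
    ∃ (y : H) (φ : ℕ → ℕ), StrictMono φ ∧ Tendsto (fun n => f (φ n)) atTop (𝓝 y) := by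
  obtain ⟨c, hc, hcb⟩ := exists_le_norm_pencil_zero hR hR1 hE
  obtain ⟨y, φ, hφ, hy⟩ := hBc f r hf
  have h1 : Tendsto (fun n => pencil R 0 E (f (φ n))) atTop (𝓝 (0 - y)) := by
    refine ((h0.comp hφ.tendsto_atTop).sub hy).congr fun n => ?_
    simp [pencil_apply]
  have h2 : AntilipschitzWith (⟨c⁻¹, by positivity⟩ : NNReal) (pencil R 0 E) := by
    refine AddMonoidHomClass.antilipschitz_of_bound _ fun x => ?_
    have := hcb x
    change ‖x‖ ≤ c⁻¹ * _
    rwa [inv_mul_eq_div, le_div_iff₀ hc, mul_comm]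
  have h3 : CauchySeq (fun n => f (φ n)) := by
    have hcs := h1.cauchySeq
    rw [Metric.cauchySeq_iff] at hcs ⊢
    intro ε hε
    obtain ⟨N, hN⟩ := hcs (c * ε) (by positivity)
    refine ⟨N, fun m hm n hn => ?_⟩
    have := hN m hm n hn
    have hb := hcb (f (φ m) - f (φ n))
    rw [map_sub, ← dist_eq_norm, ← dist_eq_norm] at hb
    exact lt_of_mul_lt_mul_left (hb.trans_lt this) hc.le
  obtain ⟨z, hz⟩ := cauchySeq_tendsto_of_complete h3
  exact ⟨z, φ, hφ, hz⟩

/-- The pencil is nonnegative for sufficiently negative `E`. -/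
lemma exists_pencil_nonneg (hR : ∀ f g, ⟪R f, g⟫_ℂ = ⟪f, R g⟫_ℂ) (hRd : DenseRange R)
    (hB : ∀ f g, ⟪B f, g⟫_ℂ = ⟪f, B g⟫_ℂ) (hBc : SeqCompactOp B) :
    ∃ E : ℝ, ∀ f, 0 ≤ (⟪f, pencil R B E f⟫_ℂ).re := by
  -- Otherwise there are unit vectors with `1 + (n + 1) ‖R f‖² < -⟪f, B f⟫`. Boundedness of `B`
  -- forces `R f → 0`, so `f` tends weakly to zero, so `B f → 0` along a subsequence by compactness,
  -- contradicting `1 < -⟪f, B f⟫`.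
  by_contra! hcon
  have hstep : ∀ n : ℕ, ∃ f : H, ‖f‖ = 1 ∧ 1 + (n + 1) * ‖R f‖ ^ 2 < -(⟪f, B f⟫_ℂ).re := by
    intro n
    obtain ⟨f, hf⟩ := hcon (-(n + 1 : ℝ) - 1)
    have hf0 : f ≠ 0 := by rintro rfl; simp at hf
    have hn : ‖f‖ ≠ 0 := norm_ne_zero_iff.2 hf0
    refine ⟨((‖f‖⁻¹ : ℝ) : ℂ) • f, ?_, ?_⟩
    · rw [norm_smul, Complex.norm_real, norm_inv, norm_norm, inv_mul_cancel₀ hn]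
    · rw [re_inner_pencil hR] at hf
      have e1 : (⟪((‖f‖⁻¹ : ℝ) : ℂ) • f, B (((‖f‖⁻¹ : ℝ) : ℂ) • f)⟫_ℂ).re =
          ‖f‖⁻¹ ^ 2 * (⟪f, B f⟫_ℂ).re := by
        rw [map_smul, inner_smul_left, inner_smul_right, Complex.conj_ofReal,
          Complex.re_ofReal_mul, Complex.re_ofReal_mul]
        ring
      have e2 : ‖R (((‖f‖⁻¹ : ℝ) : ℂ) • f)‖ = ‖f‖⁻¹ * ‖R f‖ := by
        rw [map_smul, norm_smul, Complex.norm_real, norm_inv, norm_norm]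
      rw [e1, e2]
      have hp : 0 < ‖f‖⁻¹ ^ 2 := by positivity
      have := mul_lt_mul_of_pos_left hf hp
      have e3 : ‖f‖⁻¹ ^ 2 * ‖f‖ ^ 2 = 1 := by field_simp
      nlinarith
  choose f hf1 hf2 using hstep
  have hRf : Tendsto (fun n => R (f n)) atTop (𝓝 0) := by
    rw [tendsto_zero_iff_norm_tendsto_zero]
    have hb : ∀ n : ℕ, ‖R (f n)‖ ^ 2 ≤ ‖B‖ * (1 / ((n : ℝ) + 1)) := by
      intro n
      have h1 : -(⟪f n, B (f n)⟫_ℂ).re ≤ ‖B‖ := by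
        calc -(⟪f n, B (f n)⟫_ℂ).re ≤ |(⟪f n, B (f n)⟫_ℂ).re| := neg_le_abs _
          _ ≤ ‖⟪f n, B (f n)⟫_ℂ‖ := Complex.abs_re_le_norm _
          _ ≤ ‖f n‖ * ‖B (f n)‖ := norm_inner_le_norm _ _
          _ ≤ ‖f n‖ * (‖B‖ * ‖f n‖) := by gcongr; exact B.le_opNorm _
          _ = ‖B‖ := by rw [hf1]; ring
      have h2 := hf2 n
      rw [mul_one_div, le_div_iff₀ (by positivity)]
      nlinarith
    have hlim : Tendsto (fun n : ℕ => ‖B‖ * (1 / ((n : ℝ) + 1))) atTop (𝓝 0) := by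
      simpa using tendsto_one_div_add_atTop_nhds_zero_nat.const_mul ‖B‖
    have hsq := squeeze_zero (fun n => sq_nonneg ‖R (f n)‖) hb hlim
    simpa using hsq.sqrt
  obtain ⟨y, φ, hφ, hy⟩ := hBc f 1 (fun n => (hf1 n).le)
  -- Vectors `R g` are dense, and against them `⟪R g, f n⟫ = ⟪g, R (f n)⟫` tends to zero.
  have hweak : ∀ z, Tendsto (fun n => ⟪z, f n⟫_ℂ) atTop (𝓝 0) := by
    intro z
    rw [Metric.tendsto_atTop]
    intro ε hε
    obtain ⟨g, hg⟩ := hRd.exists_dist_lt z (half_pos hε)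
    have h1 : Tendsto (fun n => ⟪g, R (f n)⟫_ℂ) atTop (𝓝 ⟪g, (0 : H)⟫_ℂ) :=
      tendsto_const_nhds.inner hRf
    rw [inner_zero_right, Metric.tendsto_atTop] at h1
    obtain ⟨N, hN⟩ := h1 (ε / 2) (half_pos hε)
    refine ⟨N, fun n hn => ?_⟩
    have h2 := hN n hn
    rw [dist_zero_right] at h2 ⊢
    have h3 : ⟪z, f n⟫_ℂ = ⟪z - R g, f n⟫_ℂ + ⟪g, R (f n)⟫_ℂ := by
      rw [inner_sub_left, hR]; ring
    rw [h3]
    have h4 : ‖⟪z - R g, f n⟫_ℂ‖ ≤ ‖z - R g‖ := by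
      have := norm_inner_le_norm (𝕜 := ℂ) (z - R g) (f n)
      rwa [hf1, mul_one] at this
    rw [dist_eq_norm] at hg
    calc _ ≤ ‖⟪z - R g, f n⟫_ℂ‖ + ‖⟪g, R (f n)⟫_ℂ‖ := norm_add_le _ _
      _ < ε := by linarith
  have hy0 : y = 0 := by
    have h1 : Tendsto (fun n => ⟪y, B (f (φ n))⟫_ℂ) atTop (𝓝 ⟪y, y⟫_ℂ) :=
      tendsto_const_nhds.inner hy
    have h2 : Tendsto (fun n => ⟪y, B (f (φ n))⟫_ℂ) atTop (𝓝 0) := by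
      simp_rw [← hB]
      exact (hweak (B y)).comp hφ.tendsto_atTop
    exact inner_self_eq_zero.1 (tendsto_nhds_unique h1 h2)
  rw [hy0] at hy
  have hn := hy.norm
  rw [norm_zero, Metric.tendsto_atTop] at hn
  obtain ⟨N, hN⟩ := hn 1 one_pos
  have h1 := hN N le_rfl
  rw [dist_zero_right, norm_norm] at h1
  have h2 := hf2 (φ N)
  have h3 : -(⟪f (φ N), B (f (φ N))⟫_ℂ).re ≤ ‖B (f (φ N))‖ := by
    calc _ ≤ |(⟪f (φ N), B (f (φ N))⟫_ℂ).re| := neg_le_abs _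
      _ ≤ ‖⟪f (φ N), B (f (φ N))⟫_ℂ‖ := Complex.abs_re_le_norm _
      _ ≤ ‖f (φ N)‖ * ‖B (f (φ N))‖ := norm_inner_le_norm _ _
      _ = _ := by rw [hf1, one_mul]
  have h4 : 0 ≤ ((φ N : ℝ) + 1) * ‖R (f (φ N))‖ ^ 2 := by positivity
  linarith

/-- If the form of `1 - R² + B` takes a negative value, then the pencil has a nontrivial kernel for
some `E < 0`. -/
theorem exists_pencil_eq_zero [CompleteSpace H]
    (hR : ∀ f g, ⟪R f, g⟫_ℂ = ⟪f, R g⟫_ℂ) (hR1 : ∀ f, ‖R f‖ ≤ ‖f‖) (hRd : DenseRange R)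
    (hB : ∀ f g, ⟪B f, g⟫_ℂ = ⟪f, B g⟫_ℂ) (hBc : SeqCompactOp B)
    {f₀ : H} (hf₀ : (⟪f₀, pencil R B 0 f₀⟫_ℂ).re < 0) :
    ∃ E : ℝ, E < 0 ∧ ∃ f ≠ 0, pencil R B E f = 0 := by
  have hshift : ∀ (E : ℝ) (f : H), (⟪f, pencil R B E f⟫_ℂ).re =
      (⟪f, pencil R B 0 f⟫_ℂ).re - E * ‖R f‖ ^ 2 := by
    intro E f
    rw [re_inner_pencil hR, re_inner_pencil hR]; ring
  -- `S` is a half-line extending to `-∞`; its supremum plays the role of the bottom of the spectrum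
  -- and turns out to be the eigenvalue.
  set S : Set ℝ := {E | ∀ f, 0 ≤ (⟪f, pencil R B E f⟫_ℂ).re} with hS
  have hne : S.Nonempty := exists_pencil_nonneg hR hRd hB hBc
  have hle : ∀ {f : H}, R f ≠ 0 → ∀ E ∈ S, E ≤ (⟪f, pencil R B 0 f⟫_ℂ).re / ‖R f‖ ^ 2 := by
    intro f hf E hE
    have h := hE f
    rw [hshift] at h
    rw [le_div_iff₀ (by positivity)]
    linarith
  -- Were `R f₀ = 0`, the form at `f₀` would be the same negative number for every `E`, and `S`
  -- would be empty.
  have hRf₀ : R f₀ ≠ 0 := by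
    intro h
    obtain ⟨E, hE⟩ := hne
    have := hE f₀
    rw [hshift, h, norm_zero] at this
    linarith
  have hbdd : BddAbove S := ⟨_, hle hRf₀⟩
  set E := sSup S with hEdef
  have hE0 : E < 0 :=
    (csSup_le hne (hle hRf₀)).trans_lt (div_neg_of_neg_of_pos hf₀ (by positivity))
  have hES : E ∈ S := by
    intro f
    rw [hshift]
    by_cases hf : R f = 0
    · obtain ⟨E', hE'⟩ := hne
      have := hE' f
      rw [hshift, hf] at this
      rw [hf]
      simpa using this
    · have := csSup_le hne (hle hf)
      rw [le_div_iff₀ (by positivity)] at this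
      linarith
  -- If the form exceeded `1 / (n + 1)` on the whole unit sphere, then, as `‖R f‖ ≤ ‖f‖`, the value
  -- `E + 1 / (n + 1)` would still belong to `S`.
  have hmin : ∀ n : ℕ, ∃ f : H, ‖f‖ = 1 ∧ (⟪f, pencil R B E f⟫_ℂ).re ≤ 1 / ((n : ℝ) + 1) := by
    intro n
    by_contra! hcon
    have hp : (0 : ℝ) < 1 / ((n : ℝ) + 1) := by positivity
    have hmem : E + 1 / ((n : ℝ) + 1) ∈ S := by
      intro f
      by_cases hf : f = 0
      · simp [hf]
      have hn : ‖f‖ ≠ 0 := norm_ne_zero_iff.2 hf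
      have h1 := hcon (((‖f‖⁻¹ : ℝ) : ℂ) • f)
        (by rw [norm_smul, Complex.norm_real, norm_inv, norm_norm, inv_mul_cancel₀ hn])
      rw [map_smul, inner_smul_left, inner_smul_right, Complex.conj_ofReal,
        Complex.re_ofReal_mul, Complex.re_ofReal_mul, hshift] at h1
      rw [hshift]
      have h2 : ‖R f‖ ^ 2 ≤ ‖f‖ ^ 2 := by gcongr; exact hR1 f
      have h3 : (1 / ((n : ℝ) + 1)) * ‖f‖ ^ 2 <
          (⟪f, pencil R B 0 f⟫_ℂ).re - E * ‖R f‖ ^ 2 := by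
        have := mul_lt_mul_of_pos_right h1 (show 0 < ‖f‖ ^ 2 by positivity)
        refine this.trans_eq ?_
        field_simp
      have h4 : (1 / ((n : ℝ) + 1)) * ‖R f‖ ^ 2 ≤ (1 / ((n : ℝ) + 1)) * ‖f‖ ^ 2 := by gcongr
      linarith
    have := le_csSup hbdd hmem
    linarith
  choose f hf1 hf2 using hmin
  have hA0 : Tendsto (fun n => pencil R B E (f n)) atTop (𝓝 0) := by
    rw [tendsto_zero_iff_norm_tendsto_zero]
    have hb : ∀ n : ℕ, ‖pencil R B E (f n)‖ ^ 2 ≤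
        (‖pencil R B E‖ + 1) * (1 / ((n : ℝ) + 1)) := fun n =>
      (norm_sq_apply_le_of_nonneg (inner_pencil_left hR hB E) hES (by positivity)
        (le_add_of_nonneg_right zero_le_one) (f n)).trans (by gcongr; exact hf2 n)
    have hlim : Tendsto (fun n : ℕ => (‖pencil R B E‖ + 1) * (1 / ((n : ℝ) + 1))) atTop (𝓝 0) := by
      simpa using tendsto_one_div_add_atTop_nhds_zero_nat.const_mul (‖pencil R B E‖ + 1)
    simpa using (squeeze_zero (fun n => sq_nonneg _) hb hlim).sqrt
  obtain ⟨y, φ, hφ, hy⟩ :=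
    exists_subseq_tendsto_of_pencil_tendsto hR hR1 hBc hE0 (fun n => (hf1 n).le) hA0
  refine ⟨E, hE0, y, ?_, ?_⟩
  · rintro rfl
    have := hy.norm
    simp only [hf1, norm_zero] at this
    exact one_ne_zero (tendsto_nhds_unique tendsto_const_nhds this)
  · exact tendsto_nhds_unique (((pencil R B E).continuous.tendsto y).comp hy)
      (hA0.comp hφ.tendsto_atTop)

/-- For `E < 0` the kernel of the pencil is finite-dimensional. -/
lemma finiteDimensional_ker_pencil [CompleteSpace H]
    (hR : ∀ f g, ⟪R f, g⟫_ℂ = ⟪f, R g⟫_ℂ) (hR1 : ∀ f, ‖R f‖ ≤ ‖f‖)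
    (hBc : SeqCompactOp B) {E : ℝ} (hE : E < 0) :
    FiniteDimensional ℂ (LinearMap.ker (pencil R B E : H →ₗ[ℂ] H)) := by
  set N := LinearMap.ker (pencil R B E : H →ₗ[ℂ] H)
  -- Riesz: sequences in the unit ball of the kernel are exact null sequences of the pencil, hence
  -- have convergent subsequences.
  refine FiniteDimensional.of_isCompact_closedBall ℂ one_pos (c := (0 : N)) ?_
  refine IsSeqCompact.isCompact fun x hx => ?_
  obtain ⟨y, φ, hφ, hy⟩ := exists_subseq_tendsto_of_pencil_tendsto hR hR1 hBc hE
    (f := fun n => (x n : H)) (r := 1) (fun n => by simpa using hx n)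
    (by
      have : ∀ n, pencil R B E (x n : H) = 0 := fun n => (x n).2
      simp only [this]
      exact tendsto_const_nhds)
  have hyN : y ∈ N := by
    have hc : IsClosed (N : Set H) := (pencil R B E).isClosed_ker
    exact hc.mem_of_tendsto hy (Eventually.of_forall fun n => (x (φ n)).2)
  refine ⟨⟨y, hyN⟩, ?_, φ, hφ, ?_⟩
  · have := hy.norm
    have h1 : ‖y‖ ≤ 1 := le_of_tendsto this
      (Eventually.of_forall fun n => by simpa using hx (φ n))
    simpa using h1
  · rw [tendsto_subtype_rng]
    exact hy

/-- If the form of `1 - R² + B` is negative on subspaces of arbitrarily large dimension, then the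
pencil has a nontrivial kernel for infinitely many `E < 0`. -/
theorem infinite_setOf_pencil_eq_zero [CompleteSpace H]
    (hR : ∀ f g, ⟪R f, g⟫_ℂ = ⟪f, R g⟫_ℂ) (hR1 : ∀ f, ‖R f‖ ≤ ‖f‖) (hRd : DenseRange R)
    (hRi : Function.Injective R)
    (hB : ∀ f g, ⟪B f, g⟫_ℂ = ⟪f, B g⟫_ℂ) (hBc : SeqCompactOp B)
    (hneg : ∀ N : ℕ, ∃ L : (Fin N → ℂ) →ₗ[ℂ] H, ∀ a ≠ 0,
      (⟪L a, pencil R B 0 (L a)⟫_ℂ).re < 0) :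
    {E : ℝ | E < 0 ∧ ∃ f ≠ 0, pencil R B E f = 0}.Infinite := by
  set S := {E : ℝ | E < 0 ∧ ∃ f ≠ 0, pencil R B E f = 0} with hS
  by_contra hfin
  rw [Set.not_infinite] at hfin
  have := hfin.to_subtype
  let K : ℝ → Submodule ℂ H := fun E =>
    (LinearMap.ker (pencil R B E : H →ₗ[ℂ] H)).map (R : H →ₗ[ℂ] H)
  let W : Submodule ℂ H := ⨆ E : S, K E
  have hKW : ∀ E ∈ S, K E ≤ W := fun E hE => le_iSup (fun E : S => K E) ⟨E, hE⟩
  have hWfd : FiniteDimensional ℂ W := by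
    have : ∀ E : S, FiniteDimensional ℂ (K E) := fun E => by
      have := finiteDimensional_ker_pencil hR hR1 hBc E.2.1
      infer_instance
    infer_instance
  obtain ⟨m, hm⟩ := hfin.bddBelow
  -- With `m` a lower bound of `S`, this choice makes `E' + c ≥ 0` for every `E' ∈ S`: the penalty
  -- `c PW` moves these eigenvalues out of the negative axis.
  set c : ℝ := -m with hc
  set PW : H →L[ℂ] H := W.starProjection with hPW
  have hPs : ∀ f g, ⟪PW f, g⟫_ℂ = ⟪f, PW g⟫_ℂ := W.inner_starProjection_left_eq_right
  set B' : H →L[ℂ] H := B + (c : ℂ) • (R ∘L PW ∘L R) with hB'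
  have hB'a : ∀ f, B' f = B f + (c : ℂ) • R (PW (R f)) := fun f => rfl
  have hpen : ∀ E f, pencil R B' E f = pencil R B E f + (c : ℂ) • R (PW (R f)) := fun E f => by
    rw [pencil_apply, pencil_apply, hB'a, add_assoc]
  have hB's : ∀ f g, ⟪B' f, g⟫_ℂ = ⟪f, B' g⟫_ℂ := fun f g => by
    rw [hB'a, hB'a, inner_add_left, inner_add_right, inner_smul_left, inner_smul_right, hB,
      hR, hPs, hR, Complex.conj_ofReal]
  have hPc : SeqCompactOp PW := by
    intro f r hf
    obtain ⟨y, -, φ, hφ, h⟩ := (isCompact_closedBall (0 : W) r).tendsto_subseq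
      (x := fun n => W.orthogonalProjectionOnto (f n)) (fun n => by
        rw [mem_closedBall_zero_iff]
        exact (W.norm_orthogonalProjectionOnto_apply_le _).trans (hf n))
    exact ⟨y, φ, hφ, (continuous_subtype_val.tendsto y).comp h⟩
  have hB'c : SeqCompactOp B' := by
    refine hBc.add (C := fun f => (c : ℂ) • R (PW (R f))) fun f r hf => ?_
    obtain ⟨y, φ, hφ, h⟩ := hPc (fun n => R (f n)) r (fun n => (hR1 _).trans (hf n))
    exact ⟨(c : ℂ) • R y, φ, hφ, ((R.continuous.tendsto y).comp h).const_smul _⟩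
  have hPzero : ∀ x, (∀ w ∈ W, ⟪w, x⟫_ℂ = 0) → PW x = 0 := fun x hx => by
    rw [hPW, Submodule.starProjection_apply_eq_zero_iff, Submodule.mem_orthogonal]
    exact hx
  -- One dimension more than `W`, so some nonzero combination is not seen by the penalty and keeps
  -- its negative form value.
  obtain ⟨L, hL⟩ := hneg (Module.finrank ℂ W + 1)
  obtain ⟨a, ha, ha0⟩ : ∃ a, PW (R (L a)) = 0 ∧ a ≠ 0 := by
    have hker : LinearMap.ker ((W.orthogonalProjectionOnto ∘L R : H →L[ℂ] W).toLinearMap ∘ₗ L) ≠ ⊥ :=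
      LinearMap.ker_ne_bot_of_finrank_lt (by simp)
    obtain ⟨a, ha, ha0⟩ := Submodule.exists_mem_ne_zero_of_ne_bot hker
    refine ⟨a, ?_, ha0⟩
    have h1 : W.orthogonalProjectionOnto (R (L a)) = 0 := ha
    rw [hPW, Submodule.starProjection_apply, h1]
    rfl
  have hf₀ : (⟪L a, pencil R B' 0 (L a)⟫_ℂ).re < 0 := by
    rw [hpen, ha, map_zero, smul_zero, add_zero]
    exact hL a ha0
  obtain ⟨E, hE, f, hf, hEf⟩ := exists_pencil_eq_zero hR hR1 hRd hB's hB'c hf₀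
  -- Pairing the penalised equation with an old kernel vector `g` at `E'` gives `(E' - E + c) ⟪R g,
  -- R f⟫ = 0`, and the factor is at least `-E > 0`.
  have horth : ∀ w ∈ W, ⟪w, R f⟫_ℂ = 0 := by
    have hWle : W ≤ (ℂ ∙ R f)ᗮ := by
      refine iSup_le fun E' => ?_
      rintro _ ⟨g, hg, rfl⟩
      have hg' : pencil R B E' g = 0 := hg
      have hmem : R g ∈ W := hKW E' E'.2 ⟨g, hg, rfl⟩
      rw [Submodule.mem_orthogonal_singleton_iff_inner_left]
      change ⟪R g, R f⟫_ℂ = 0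
      have h1 : ⟪g, pencil R B E f⟫_ℂ = ((E' - E : ℝ) : ℂ) * ⟪R g, R f⟫_ℂ := by
        have e : pencil R B E f = pencil R B E' f + ((E' - E : ℝ) : ℂ) • R (R f) := by
          rw [pencil_apply, pencil_apply]
          push_cast
          module
        rw [e, inner_add_right, ← inner_pencil_left hR hB, hg', inner_zero_left, zero_add,
          inner_smul_right, ← hR]
      have h2 : ⟪g, R (PW (R f))⟫_ℂ = ⟪R g, R f⟫_ℂ := by
        rw [← hR, ← hPs, hPW, Submodule.starProjection_eq_self_iff.2 hmem]
      have h3 : ⟪g, pencil R B' E f⟫_ℂ = 0 := by rw [hEf, inner_zero_right]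
      rw [hpen, inner_add_right, h1, inner_smul_right, h2, ← add_mul] at h3
      refine (mul_eq_zero.1 h3).resolve_left ?_
      have hmE : m ≤ E' := hm E'.2
      have hpos : 0 < E' - E + c := by rw [hc]; linarith
      exact_mod_cast hpos.ne'
    intro w hw
    exact (Submodule.mem_orthogonal_singleton_iff_inner_left).1 (hWle hw)
  have hP0 := hPzero _ horth
  rw [hpen, hP0, map_zero, smul_zero, add_zero] at hEf
  have hmem : R f ∈ W := hKW E ⟨hE, f, hf, hEf⟩ ⟨f, hEf, rfl⟩
  have h0 : R f = 0 := inner_self_eq_zero.1 (horth _ hmem)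
  exact hf (hRi (h0.trans (map_zero R).symm))

end PairOperator

end Pencil

/-! ### From the pencil to eigenvalues of the form sum. -/

section FormSum

open Filter Topology

namespace PairOperator

lemma inner_eq_integral (f g : L2) : ⟪f, g⟫_ℂ = ∫ x, conj (f x) * g x := by
  rw [L2.inner_def]
  refine integral_congr_ae (Eventually.of_forall fun x => ?_)
  simp only [RCLike.inner_apply]
  ring

lemma invSqrtOp_symm (T : KineticSymbol) (f g : L2) :
    ⟪invSqrtOp T f, g⟫_ℂ = ⟪f, invSqrtOp T g⟫_ℂ := by
  rw [← Lp.inner_fourier_eq, ← Lp.inner_fourier_eq f, inner_eq_integral, inner_eq_integral]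
  refine integral_congr_ae ?_
  filter_upwards [fourier_invSqrtOp T f, fourier_invSqrtOp T g] with ξ h1 h2
  rw [h1, h2, map_mul, Complex.conj_ofReal]
  ring

lemma invSqrt_le_one (T : KineticSymbol) (ξ : R3) : (√(T.freq ξ + 1))⁻¹ ≤ 1 := by
  refine inv_le_one_of_one_le₀ ?_
  rw [Real.one_le_sqrt]
  linarith [T.freq_nonneg ξ]

lemma invSqrt_pos (T : KineticSymbol) (ξ : R3) : 0 < (√(T.freq ξ + 1))⁻¹ := by
  have := T.freq_nonneg ξ
  positivity

lemma norm_invSqrtOp_le (T : KineticSymbol) (f : L2) : ‖invSqrtOp T f‖ ≤ ‖f‖ := by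
  rw [← Lp.norm_fourier_eq, ← Lp.norm_fourier_eq f]
  refine Lp.norm_le_norm_of_ae_le ?_
  filter_upwards [fourier_invSqrtOp T f] with ξ h
  rw [h, norm_mul, Complex.norm_real, Real.norm_of_nonneg (invSqrt_pos T ξ).le]
  exact mul_le_of_le_one_left (norm_nonneg _) (invSqrt_le_one T ξ)

lemma fourier_injective : Function.Injective (fun f : L2 => (𝓕 f : L2)) :=
  (Lp.fourierTransformₗᵢ R3 ℂ).injective

lemma invSqrtOp_injective (T : KineticSymbol) : Function.Injective (invSqrtOp T) := by
  refine (injective_iff_map_eq_zero _).2 fun f hf => ?_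
  refine fourier_injective ?_
  simp only [FourierTransform.fourier_zero]
  rw [Lp.eq_zero_iff_ae_eq_zero]
  have h0 : (𝓕 (invSqrtOp T f) : L2) = 0 := by rw [hf, FourierTransform.fourier_zero]
  rw [Lp.eq_zero_iff_ae_eq_zero] at h0
  filter_upwards [fourier_invSqrtOp T f, h0] with ξ h1 h2
  rw [h1] at h2
  exact (mul_eq_zero.1 h2).resolve_left (by exact_mod_cast (invSqrt_pos T ξ).ne')

/-- For a symmetric operator the orthogonal complement of the range is contained in the kernel. -/
lemma denseRange_of_symm_injective {H : Type*} [NormedAddCommGroup H] [InnerProductSpace ℂ H]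
    [CompleteSpace H] {R : H →L[ℂ] H} (hR : ∀ f g, ⟪R f, g⟫_ℂ = ⟪f, R g⟫_ℂ)
    (hRi : Function.Injective R) : DenseRange R := by
  have h : (LinearMap.range (R : H →ₗ[ℂ] H))ᗮ = ⊥ := by
    rw [Submodule.eq_bot_iff]
    intro x hx
    refine hRi ?_
    rw [map_zero, ← inner_self_eq_zero (𝕜 := ℂ), hR]
    rw [Submodule.mem_orthogonal'] at hx
    exact hx _ ⟨R x, rfl⟩
  have h2 := Submodule.topologicalClosure_eq_top_iff.2 h
  rw [← Submodule.dense_iff_topologicalClosure_eq_top] at h2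
  exact h2

/-- The form domain of `T(p)` is the range of `(T(p) + 1)^{-1/2}`. -/
lemma exists_invSqrtOp_eq {T : KineticSymbol} {ψ : L2} (hψ : ψ ∈ kineticFormDomain T) :
    ∃ f, invSqrtOp T f = ψ := by
  have h1 : MemLp (fun ξ => ((√|T.freq ξ| : ℝ) : ℂ) * (𝓕 ψ : L2) ξ) 2 volume := hψ
  have h2 : MemLp (fun ξ => ((√(T.freq ξ + 1) : ℝ) : ℂ) * (𝓕 ψ : L2) ξ) 2 volume := by
    have h0 : Measurable (fun ξ => ((√(T.freq ξ + 1) : ℝ) : ℂ)) := by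
      have := T.measurable_freq
      fun_prop
    refine (h1.norm.add (Lp.memLp (𝓕 ψ : L2)).norm).mono
      (h0.aestronglyMeasurable.mul (Lp.aestronglyMeasurable _)) (Eventually.of_forall fun ξ => ?_)
    have hT := T.freq_nonneg ξ
    simp only [Pi.add_apply, norm_mul, Complex.norm_real, Real.norm_eq_abs,
      abs_of_nonneg (Real.sqrt_nonneg _), abs_of_nonneg hT]
    rw [abs_of_nonneg (by positivity), ← add_one_mul]
    gcongr
    rw [Real.sqrt_le_left (by positivity)]
    nlinarith [Real.sq_sqrt hT, Real.sqrt_nonneg (T.freq ξ)]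
  refine ⟨(𝓕⁻ (h2.toLp _ : L2) : L2), fourier_injective ?_⟩
  refine Lp.ext ?_
  have h3 := fourier_invSqrtOp T (𝓕⁻ (h2.toLp _ : L2) : L2)
  rw [FourierTransform.fourier_fourierInv_eq] at h3
  filter_upwards [h3, h2.coeFn_toLp] with ξ h4 h5
  rw [h4, h5, ← mul_assoc, ← Complex.ofReal_mul, inv_mul_cancel₀, Complex.ofReal_one, one_mul]
  have := T.freq_nonneg ξ
  positivity

lemma mem_sumFormDomain {T : KineticSymbol} {V : R3 → ℝ} (hV : AEMeasurable V volume)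
    (hc : RelFormCompact T V) {ψ : L2} (hψ : ψ ∈ kineticFormDomain T) : ψ ∈ sumFormDomain T V := by
  obtain ⟨f, rfl⟩ := exists_invSqrtOp_eq hψ
  exact invSqrtOp_mem hV hc f

/-- The operator `|V|^{1/2} (T(p) + 1)^{-1/2}`. -/
lemma exists_sqrtWeight_comp {T : KineticSymbol} {V : R3 → ℝ} (hV : AEMeasurable V volume)
    (hc : RelFormCompact T V) : ∃ J : L2 →L[ℂ] L2,
      (∀ f, J f =ᵐ[volume] fun x => ((√|V x| : ℝ) : ℂ) * invSqrtOp T f x) ∧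
      ∃ K : L2 →L[ℂ] L2, IsCompactOperator K ∧ ∀ f g, ⟪J f, J g⟫_ℂ = ⟪f, K g⟫_ℂ := by
  have hmem : ∀ f, MemLp (fun x => ((√|V x| : ℝ) : ℂ) * invSqrtOp T f x) 2 volume :=
    fun f => (invSqrtOp_mem hV hc f).2
  obtain ⟨K, hKc, hK⟩ := hc
  let J₀ : L2 →ₗ[ℂ] L2 :=
    { toFun := fun f => (hmem f).toLp _
      map_add' := fun f g => by
        refine Lp.ext ?_
        filter_upwards [(hmem (f + g)).coeFn_toLp, (hmem f).coeFn_toLp, (hmem g).coeFn_toLp,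
          Lp.coeFn_add ((hmem f).toLp _) ((hmem g).toLp _),
          Lp.coeFn_add (invSqrtOp T f) (invSqrtOp T g)] with x h1 h2 h3 h4 h5
        rw [h1, h4, Pi.add_apply, h2, h3, map_add, h5, Pi.add_apply, mul_add]
      map_smul' := fun c f => by
        refine Lp.ext ?_
        filter_upwards [(hmem (c • f)).coeFn_toLp, (hmem f).coeFn_toLp,
          Lp.coeFn_smul c ((hmem f).toLp _), Lp.coeFn_smul c (invSqrtOp T f)] with x h1 h2 h3 h4
        rw [h1, RingHom.id_apply, h3, Pi.smul_apply, h2, map_smul, h4, Pi.smul_apply, smul_eq_mul,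
          smul_eq_mul, mul_left_comm] }
  have hJ₀ : ∀ f, J₀ f =ᵐ[volume] fun x => ((√|V x| : ℝ) : ℂ) * invSqrtOp T f x :=
    fun f => (hmem f).coeFn_toLp
  have hin : ∀ f g, ⟪J₀ f, J₀ g⟫_ℂ = ⟪f, K g⟫_ℂ := by
    intro f g
    rw [← (hK f g).2, inner_eq_integral]
    refine integral_congr_ae ?_
    filter_upwards [hJ₀ f, hJ₀ g] with x h1 h2
    rw [h1, h2, map_mul, Complex.conj_ofReal]
    have hs : ((√|V x| : ℝ) : ℂ) * ((√|V x| : ℝ) : ℂ) = ((|V x| : ℝ) : ℂ) := by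
      rw [← Complex.ofReal_mul, Real.mul_self_sqrt (abs_nonneg _)]
    rw [← hs]; ring
  have hbound : ∀ f, ‖J₀ f‖ ≤ √‖K‖ * ‖f‖ := by
    intro f
    have h1 : ‖J₀ f‖ ^ 2 ≤ ‖K‖ * ‖f‖ ^ 2 := by
      have : ((‖J₀ f‖ ^ 2 : ℝ) : ℂ) = ⟪f, K f⟫_ℂ := by
        rw [← hin, inner_self_eq_norm_sq_to_K]; norm_cast
      calc ‖J₀ f‖ ^ 2 = ‖⟪f, K f⟫_ℂ‖ := by
            rw [← this, Complex.norm_real, Real.norm_of_nonneg (sq_nonneg _)]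
        _ ≤ ‖f‖ * ‖K f‖ := norm_inner_le_norm _ _
        _ ≤ ‖f‖ * (‖K‖ * ‖f‖) := by gcongr; exact K.le_opNorm _
        _ = _ := by ring
    refine le_of_sq_le_sq ?_ (by positivity)
    rwa [mul_pow, Real.sq_sqrt (norm_nonneg _)]
  exact ⟨J₀.mkContinuous _ hbound, hJ₀, K, hKc, hin⟩

/-- An operator `J` is compact if `J* J` is. -/
lemma seqCompactOp_of_inner_eq {H : Type*} [NormedAddCommGroup H] [InnerProductSpace ℂ H]
    [CompleteSpace H] {J K : H →L[ℂ] H} (hK : IsCompactOperator K)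
    (h : ∀ f g, ⟪J f, J g⟫_ℂ = ⟪f, K g⟫_ℂ) : SeqCompactOp J := by
  intro f r hf
  obtain ⟨y, φ, hφ, hy⟩ := SeqCompactOp.of_isCompactOperator hK f r hf
  have hr : 0 ≤ r := (norm_nonneg _).trans (hf 0)
  have hcs : CauchySeq (fun n => J (f (φ n))) := by
    have h1 := hy.cauchySeq
    rw [Metric.cauchySeq_iff] at h1 ⊢
    intro ε hε
    -- `‖J g‖² = ⟪g, K g⟫ ≤ 2 r ‖K g‖`; the extra `1` in the denominator covers `r = 0`.
    obtain ⟨N, hN⟩ := h1 (ε ^ 2 / (2 * r + 1)) (by positivity)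
    refine ⟨N, fun m hm n hn => ?_⟩
    have h2 := hN m hm n hn
    rw [dist_eq_norm, ← map_sub] at h2 ⊢
    set g := f (φ m) - f (φ n)
    have hg : ‖g‖ ≤ 2 * r := (norm_sub_le _ _).trans (by linarith [hf (φ m), hf (φ n)])
    refine lt_of_pow_lt_pow_left₀ 2 hε.le ?_
    have e : ((‖J g‖ ^ 2 : ℝ) : ℂ) = ⟪g, K g⟫_ℂ := by
      rw [← h, inner_self_eq_norm_sq_to_K]; norm_cast
    calc ‖J g‖ ^ 2 = ‖⟪g, K g⟫_ℂ‖ := by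
          rw [← e, Complex.norm_real, Real.norm_of_nonneg (sq_nonneg _)]
      _ ≤ ‖g‖ * ‖K g‖ := norm_inner_le_norm _ _
      _ ≤ (2 * r) * ‖K g‖ := by gcongr
      _ ≤ (2 * r + 1) * ‖K g‖ := by gcongr; linarith
      _ < (2 * r + 1) * (ε ^ 2 / (2 * r + 1)) := by gcongr
      _ = ε ^ 2 := by field_simp
  obtain ⟨z, hz⟩ := cauchySeq_tendsto_of_complete hcs
  exact ⟨z, φ, hφ, hz⟩

lemma mulOp_apply {m : R3 → ℂ} (hm : MemLp m ∞ volume) (f : L2) :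
    mulOp m hm f =ᵐ[volume] fun x => m x * f x := by
  have h : mulOp m hm f = (ContinuousLinearMap.mul ℂ ℂ).holder 2 (hm.toLp m) f := rfl
  rw [h]
  filter_upwards [(ContinuousLinearMap.mul ℂ ℂ).coeFn_holder (r := 2) (hm.toLp m) f,
    hm.coeFn_toLp] with ξ h1 h2
  rw [h1, h2]
  rfl

/-- The compact operator `(T(p) + 1)^{-1/2} V (T(p) + 1)^{-1/2}`. -/
lemma exists_potentialOp {T : KineticSymbol} {V : R3 → ℝ} (hV : AEMeasurable V volume)
    (hc : RelFormCompact T V) : ∃ B : L2 →L[ℂ] L2, SeqCompactOp B ∧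
      (∀ f g, ⟪B f, g⟫_ℂ = ⟪f, B g⟫_ℂ) ∧
      ∀ f g, ⟪f, B g⟫_ℂ = ∫ x, (V x : ℂ) * (conj (invSqrtOp T f x) * invSqrtOp T g x) := by
  obtain ⟨J, hJ, K, hKc, hK⟩ := exists_sqrtWeight_comp hV hc
  -- Factor `R V R = J* sign(V) J` with `J = |V|^{1/2} R`, so compactness is inherited from `J`.
  have hs : MemLp (fun x => ((SignType.sign (V x) : ℝ) : ℂ)) ∞ (volume : Measure R3) := by
    have hm : AEMeasurable (fun x => ((SignType.sign (V x) : ℝ) : ℂ)) volume := by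
      have h1 : Measurable (fun t : ℝ => ((SignType.sign t : ℝ) : ℂ)) := by
        have h2 : (fun t : ℝ => ((SignType.sign t : ℝ) : ℂ)) =
            fun t => if 0 < t then 1 else if t < 0 then -1 else 0 := by
          funext t
          rw [sign_apply]
          split_ifs <;> simp
        rw [h2]
        exact Measurable.ite measurableSet_Ioi measurable_const
          (Measurable.ite measurableSet_Iio measurable_const measurable_const)
      exact h1.comp_aemeasurable hV
    refine memLp_top_of_bound hm.aestronglyMeasurable 1 (Eventually.of_forall fun x => ?_)
    rw [Complex.norm_real]
    rcases lt_trichotomy (V x) 0 with h | h | h <;> simp [h]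
  have hB : ∀ f g, ⟪f, (J.adjoint ∘L mulOp _ hs ∘L J) g⟫_ℂ =
      ∫ x, (V x : ℂ) * (conj (invSqrtOp T f x) * invSqrtOp T g x) := by
    intro f g
    rw [ContinuousLinearMap.comp_apply, ContinuousLinearMap.adjoint_inner_right, inner_eq_integral]
    refine integral_congr_ae ?_
    filter_upwards [hJ f, hJ g, mulOp_apply hs (J g)] with x h1 h2 h3
    rw [ContinuousLinearMap.comp_apply, h1, h3, h2, map_mul, Complex.conj_ofReal]
    have e : (V x : ℂ) = ((SignType.sign (V x) : ℝ) : ℂ) *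
        (((√|V x| : ℝ) : ℂ) * ((√|V x| : ℝ) : ℂ)) := by
      rw [← Complex.ofReal_mul, Real.mul_self_sqrt (abs_nonneg _), ← Complex.ofReal_mul,
        sign_mul_abs]
    rw [e]; ring
  refine ⟨J.adjoint ∘L mulOp _ hs ∘L J, ?_, fun f g => ?_, hB⟩
  · intro f r hf
    obtain ⟨y, φ, hφ, hy⟩ := seqCompactOp_of_inner_eq hKc hK f r hf
    exact ⟨_, φ, hφ, ((J.adjoint ∘L mulOp _ hs).continuous.tendsto y).comp hy⟩
  · rw [← inner_conj_symm, hB, hB, ← integral_conj]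
    refine integral_congr_ae (Eventually.of_forall fun x => ?_)
    simp only [map_mul, Complex.conj_ofReal, Complex.conj_conj]
    ring

/-- The form of `T(p) + V` in terms of the operator pencil. -/
lemma sumForm_invSqrtOp {T : KineticSymbol} {V : R3 → ℝ} {B : L2 →L[ℂ] L2}
    (hB : ∀ f g, ⟪f, B g⟫_ℂ = ∫ x, (V x : ℂ) * (conj (invSqrtOp T f x) * invSqrtOp T g x))
    (f g : L2) :
    sumForm T V (invSqrtOp T f) (invSqrtOp T g) = ⟪f, pencil (invSqrtOp T) B 0 g⟫_ℂ := by
  rw [pencil_apply, inner_add_right, hB, inner_sub_right, add_zero, Complex.ofReal_one, one_smul,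
    ← invSqrtOp_symm, ← Lp.inner_fourier_eq, ← Lp.inner_fourier_eq (invSqrtOp T f),
    inner_eq_integral, inner_eq_integral]
  have hint : ∀ u v : L2, Integrable (fun x => conj (u x) * v x) volume := fun u v => by
    refine (L2.integrable_inner (𝕜 := ℂ) u v).congr (Eventually.of_forall fun x => ?_)
    simp only [RCLike.inner_apply]
    ring
  rw [← integral_sub (hint _ _) (hint _ _)]
  unfold sumForm
  congr 1
  refine integral_congr_ae ?_
  filter_upwards [fourier_invSqrtOp T f, fourier_invSqrtOp T g] with ξ h1 h2
  rw [h1, h2, map_mul, Complex.conj_ofReal]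
  have e : ((((√(T.freq ξ + 1))⁻¹ : ℝ) : ℂ)) * (((√(T.freq ξ + 1))⁻¹ : ℝ) : ℂ) *
      ((T.freq ξ : ℂ) + 1) = 1 := by
    have hT := T.freq_nonneg ξ
    have h3 : (√(T.freq ξ + 1))⁻¹ * (√(T.freq ξ + 1))⁻¹ * (T.freq ξ + 1) = 1 := by
      rw [← mul_inv, Real.mul_self_sqrt (by linarith), inv_mul_cancel₀ (by positivity)]
    exact_mod_cast h3
  linear_combination (conj ((𝓕 f : L2) ξ) * (𝓕 g : L2) ξ) * e

/-- Kernel vectors of the pencil give eigenvectors of the form sum. -/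
lemma isEigenvalue_of_pencil_eq_zero {T : KineticSymbol} {V : R3 → ℝ} (hV : AEMeasurable V volume)
    (hc : RelFormCompact T V) {B : L2 →L[ℂ] L2}
    (hB : ∀ f g, ⟪f, B g⟫_ℂ = ∫ x, (V x : ℂ) * (conj (invSqrtOp T f x) * invSqrtOp T g x))
    {E : ℝ} {f : L2} (hf : f ≠ 0) (h : pencil (invSqrtOp T) B E f = 0) :
    IsEigenvalue (formSum T V hV) E := by
  have hmem : (invSqrtOp T f, (E : ℂ) • invSqrtOp T f) ∈ formGraph T V hV := by
    refine ⟨invSqrtOp_mem hV hc f, fun φ hφ => ?_⟩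
    obtain ⟨g, rfl⟩ := exists_invSqrtOp_eq hφ.1
    have e : pencil (invSqrtOp T) B 0 f =
        pencil (invSqrtOp T) B E f + (E : ℂ) • invSqrtOp T (invSqrtOp T f) := by
      rw [pencil_apply, pencil_apply]
      push_cast
      module
    rw [sumForm_invSqrtOp hB, e, h, zero_add, inner_smul_right, inner_smul_right, invSqrtOp_symm]
  have hg : (invSqrtOp T f, (E : ℂ) • invSqrtOp T f) ∈ (formSum T V hV).graph := by
    unfold formSum
    rwa [Submodule.toLinearPMap_graph_eq _ (formGraph_single_valued hV hc)]
  rw [LinearPMap.mem_graph_iff] at hg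
  obtain ⟨ψ, h1, h2⟩ := hg
  refine ⟨ψ, ?_, ?_⟩
  · rw [h1]
    exact fun h0 => hf (invSqrtOp_injective T (h0.trans (map_zero _).symm))
  · rw [h2, h1]

/-- A negative form value produces a negative eigenvalue. -/
theorem exists_isEigenvalue_of_sumForm_neg {T : KineticSymbol} {V : R3 → ℝ}
    (hV : AEMeasurable V volume) (hc : RelFormCompact T V) {ψ : L2}
    (hψ : ψ ∈ kineticFormDomain T) (hneg : (sumForm T V ψ ψ).re < 0) :
    ∃ E : ℝ, E < 0 ∧ IsEigenvalue (formSum T V hV) E := by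
  obtain ⟨B, hBc, hBs, hB⟩ := exists_potentialOp hV hc
  obtain ⟨f, rfl⟩ := exists_invSqrtOp_eq hψ
  rw [sumForm_invSqrtOp hB] at hneg
  obtain ⟨E, hE, g, hg, h⟩ := exists_pencil_eq_zero (invSqrtOp_symm T) (norm_invSqrtOp_le T)
    (denseRange_of_symm_injective (invSqrtOp_symm T) (invSqrtOp_injective T)) hBs hBc hneg
  exact ⟨E, hE, isEigenvalue_of_pencil_eq_zero hV hc hB hg h⟩

/-- If the form is negative on subspaces of arbitrarily large dimension, then there are infinitely
many negative eigenvalues. -/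
theorem infinite_isEigenvalue_of_sumForm_neg {T : KineticSymbol} {V : R3 → ℝ}
    (hV : AEMeasurable V volume) (hc : RelFormCompact T V)
    (h : ∀ N : ℕ, ∃ ψ : Fin N → L2, (∀ j, ψ j ∈ kineticFormDomain T) ∧
      ∀ a : Fin N → ℂ, a ≠ 0 → (sumForm T V (∑ j, a j • ψ j) (∑ j, a j • ψ j)).re < 0) :
    {E : ℝ | E < 0 ∧ IsEigenvalue (formSum T V hV) E}.Infinite := by
  obtain ⟨B, hBc, hBs, hB⟩ := exists_potentialOp hV hc
  refine Set.Infinite.mono (s := {E : ℝ | E < 0 ∧ ∃ f ≠ 0, pencil (invSqrtOp T) B E f = 0})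
    (fun E hE => ?_) (infinite_setOf_pencil_eq_zero (invSqrtOp_symm T) (norm_invSqrtOp_le T)
      (denseRange_of_symm_injective (invSqrtOp_symm T) (invSqrtOp_injective T))
      (invSqrtOp_injective T) hBs hBc fun N => ?_)
  · obtain ⟨hE0, g, hg, hEg⟩ := hE
    exact ⟨hE0, isEigenvalue_of_pencil_eq_zero hV hc hB hg hEg⟩
  obtain ⟨ψ, hψ, hneg⟩ := h N
  choose f hf using fun j => exists_invSqrtOp_eq (hψ j)
  refine ⟨Fintype.linearCombination ℂ f, fun a ha => ?_⟩
  have e : invSqrtOp T (Fintype.linearCombination ℂ f a) = ∑ j, a j • ψ j := by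
    rw [Fintype.linearCombination_apply, map_sum]
    exact Finset.sum_congr rfl fun j _ => by rw [map_smul, hf]
  rw [← sumForm_invSqrtOp hB, e]
  exact hneg a ha

end PairOperator

end FormSum

/-! ### Inverse Fourier transforms and trial states of small kinetic energy. -/

section FourierInversion

open Filter Topology

namespace PairOperator

/-- On `L¹ ∩ L²` the inverse Fourier transform is given by the integral. -/
lemma fourierInv_toLp_ae_eq {h : R3 → ℂ} (h1 : Integrable h) (h2 : MemLp h 2 volume) :
    ((𝓕⁻ (h2.toLp h : L2) : L2) : R3 → ℂ) =ᵐ[volume] fun x => (𝓕⁻ h : R3 → ℂ) x := by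
  have hL : Continuous fun p : R3 × R3 => (-innerₗ R3) p.1 p.2 := continuous_inner.neg
  have hflip : (-innerₗ R3).flip = -innerₗ R3 := by
    ext x y
    simp [real_inner_comm]
  have hcont : Continuous (𝓕⁻ h : R3 → ℂ) :=
    VectorFourier.fourierIntegral_continuous Real.continuous_fourierChar hL h1
  -- Both sides are tested against smooth compactly supported `g`: the `L²` transform moves onto `g`
  -- by duality of tempered distributions, the integral transform by Fubini.
  refine ae_eq_of_integral_contDiff_smul_eq
    ((Lp.memLp (𝓕⁻ (h2.toLp h : L2) : L2)).locallyIntegrable (by norm_num))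
    hcont.locallyIntegrable fun g hg hgc => ?_
  have hg1 : HasCompactSupport (Complex.ofRealCLM ∘ g) := hgc.comp_left rfl
  have hg2 : ContDiff ℝ (↑(⊤ : ℕ∞)) (Complex.ofRealCLM ∘ g) := by fun_prop
  set G : SchwartzMap R3 ℂ := hg1.toSchwartzMap hg2 with hG
  have hGa : ∀ x, G x = (g x : ℂ) := fun x => rfl
  have e1 := congrArg (fun D => D G) (Lp.fourierInv_toTemperedDistribution_eq (h2.toLp h : L2))
  simp only [TemperedDistribution.fourierInv_apply, Lp.toTemperedDistribution_apply] at e1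
  have e2 := VectorFourier.integral_fourierIntegral_smul_eq_flip (L := -innerₗ R3)
    (μ := volume) (ν := volume) Real.continuous_fourierChar hL G.integrable h1
  rw [hflip] at e2
  calc ∫ x, g x • (𝓕⁻ (h2.toLp h : L2) : L2) x = ∫ x, G x • (𝓕⁻ (h2.toLp h : L2) : L2) x := rfl
    _ = ∫ x, (𝓕⁻ G : SchwartzMap R3 ℂ) x • (h2.toLp h : L2) x := e1.symm
    _ = ∫ x, (𝓕⁻ (G : R3 → ℂ)) x • h x := by
        refine integral_congr_ae ?_
        filter_upwards [h2.coeFn_toLp] with x hx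
        rw [hx, SchwartzMap.fourierInv_coe]
    _ = ∫ x, G x • (𝓕⁻ h : R3 → ℂ) x := e2
    _ = _ := rfl

/-- The inverse Fourier transform of a probability density is bounded by one. -/
lemma norm_fourierInv_le_one {h : R3 → ℝ} (h0 : ∀ ξ, 0 ≤ h ξ) (h1 : ∫ ξ, h ξ = 1) (x : R3) :
    ‖(𝓕⁻ (fun ξ => (h ξ : ℂ)) : R3 → ℂ) x‖ ≤ 1 := by
  rw [Real.fourierInv_eq, ← h1]
  refine (norm_integral_le_integral_norm _).trans_eq (integral_congr_ae
    (Eventually.of_forall fun ξ => ?_))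
  simp only [Circle.norm_smul, Complex.norm_real, Real.norm_of_nonneg (h0 ξ)]

/-- The inverse Fourier transform of a probability density concentrated near `ω` is close to the
plane wave with frequency `ω`. -/
lemma norm_fourierInv_sub_le {h : R3 → ℝ} (hi : Integrable h) (h0 : ∀ ξ, 0 ≤ h ξ)
    (h1 : ∫ ξ, h ξ = 1) {ω : R3} {δ : ℝ} (hs : ∀ ξ, h ξ ≠ 0 → ‖ξ - ω‖ ≤ δ) (x : R3) :
    ‖(𝓕⁻ (fun ξ => (h ξ : ℂ)) : R3 → ℂ) x - (Real.fourierChar ⟪ω, x⟫_ℝ : ℂ)‖ ≤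
      2 * Real.pi * δ * ‖x‖ := by
  have hic : Integrable (fun ξ => (h ξ : ℂ)) volume := hi.ofReal
  have hconv : Integrable (fun ξ => (Real.fourierChar ⟪ξ, x⟫_ℝ : ℂ) * (h ξ : ℂ)) volume := by
    refine hic.mono ?_ (Eventually.of_forall fun ξ => ?_)
    · have hc : Continuous fun ξ : R3 => (Real.fourierChar ⟪ξ, x⟫_ℝ : ℂ) := by fun_prop
      exact hc.aestronglyMeasurable.mul hic.aestronglyMeasurable
    · rw [norm_mul, Circle.norm_coe, one_mul]
  have hconst : (Real.fourierChar ⟪ω, x⟫_ℝ : ℂ) =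
      ∫ ξ, (Real.fourierChar ⟪ω, x⟫_ℝ : ℂ) * (h ξ : ℂ) := by
    rw [integral_const_mul, integral_complex_ofReal, h1, Complex.ofReal_one, mul_one]
  have hF : (𝓕⁻ (fun ξ => (h ξ : ℂ)) : R3 → ℂ) x =
      ∫ ξ, (Real.fourierChar ⟪ξ, x⟫_ℝ : ℂ) * (h ξ : ℂ) := Real.fourierInv_eq _ _
  rw [hF, hconst, ← integral_sub hconv (hic.const_mul _)]
  have hb : 2 * Real.pi * δ * ‖x‖ = ∫ ξ, 2 * Real.pi * δ * ‖x‖ * h ξ := by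
    rw [integral_const_mul, h1, mul_one]
  rw [hb]
  refine norm_integral_le_of_norm_le (hi.const_mul _) (Eventually.of_forall fun ξ => ?_)
  rw [← sub_mul, norm_mul, Complex.norm_real, Real.norm_of_nonneg (h0 ξ)]
  by_cases hξ : h ξ = 0
  · simp [hξ]
  refine mul_le_mul_of_nonneg_right ?_ (h0 ξ)
  have e : (Real.fourierChar ⟪ξ, x⟫_ℝ : ℂ) - (Real.fourierChar ⟪ω, x⟫_ℝ : ℂ) =
      (Real.fourierChar ⟪ω, x⟫_ℝ : ℂ) *
        (Complex.exp (Complex.I * ((2 * Real.pi * ⟪ξ - ω, x⟫_ℝ : ℝ) : ℂ)) - 1) := by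
    have e1 : Complex.exp (Complex.I * ((2 * Real.pi * ⟪ξ - ω, x⟫_ℝ : ℝ) : ℂ)) =
        (Real.fourierChar ⟪ξ - ω, x⟫_ℝ : ℂ) := by
      rw [Real.fourierChar_apply, mul_comm]
    rw [e1, mul_sub, mul_one, ← Circle.coe_mul, ← AddChar.map_add_eq_mul, ← inner_add_left,
      add_sub_cancel]
  rw [e, norm_mul, Circle.norm_coe, one_mul]
  refine Real.norm_exp_I_mul_ofReal_sub_one_le.trans ?_
  rw [Real.norm_eq_abs, abs_mul, abs_of_nonneg (by positivity : 0 ≤ 2 * Real.pi)]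
  calc 2 * Real.pi * |⟪ξ - ω, x⟫_ℝ| ≤ 2 * Real.pi * (‖ξ - ω‖ * ‖x‖) := by
        gcongr; exact abs_real_inner_le_norm _ _
    _ ≤ 2 * Real.pi * (δ * ‖x‖) := by gcongr; exact hs ξ hξ
    _ = _ := by ring

/-! ### Energies -/

lemma mem_weightDomain_iff {w : R3 → ℝ} (hw : AEMeasurable w volume) {f : L2} :
    f ∈ weightDomain w ↔ Integrable (fun x => |w x| * ‖f x‖ ^ 2) volume := by
  have h0 : AEMeasurable (fun x => ((√|w x| : ℝ) : ℂ)) volume := by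
    have h' : AEMeasurable (fun x => |w x|) volume := hw.abs
    fun_prop
  have hmeas : AEStronglyMeasurable (fun x => ((√|w x| : ℝ) : ℂ) * f x) volume :=
    h0.aestronglyMeasurable.mul (Lp.aestronglyMeasurable _)
  change MemLp (fun x => ((√|w x| : ℝ) : ℂ) * f x) 2 volume ↔ _
  rw [memLp_two_iff_integrable_sq_norm hmeas]
  refine integrable_congr (Eventually.of_forall fun x => ?_)
  simp only [norm_mul, Complex.norm_real, Real.norm_eq_abs, mul_pow, sq_abs,
    Real.sq_sqrt (abs_nonneg (w x))]

lemma mem_kineticFormDomain_iff {T : KineticSymbol} {f : L2} :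
    f ∈ kineticFormDomain T ↔ Integrable (fun ξ => T.freq ξ * ‖(𝓕 f : L2) ξ‖ ^ 2) volume := by
  rw [mem_kineticFormDomain, mem_weightDomain_iff T.measurable_freq.aemeasurable]
  simp only [abs_of_nonneg (T.freq_nonneg _)]

/-- The kinetic energy `⟨ψ, T(p) ψ⟩`. -/
noncomputable def kineticEnergy (T : KineticSymbol) (ψ : L2) : ℝ :=
  ∫ ξ, T.freq ξ * ‖(𝓕 ψ : L2) ξ‖ ^ 2

lemma kineticEnergy_nonneg (T : KineticSymbol) (ψ : L2) : 0 ≤ kineticEnergy T ψ :=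
  integral_nonneg fun ξ => mul_nonneg (T.freq_nonneg ξ) (sq_nonneg _)

lemma re_sumForm_self (T : KineticSymbol) (V : R3 → ℝ) (ψ : L2) :
    (sumForm T V ψ ψ).re = kineticEnergy T ψ + ∫ x, V x * ‖ψ x‖ ^ 2 := by
  have h : ∀ (w : R3 → ℝ) (f : L2), ∫ x, (w x : ℂ) * (conj (f x) * f x) =
      ((∫ x, w x * ‖f x‖ ^ 2 : ℝ) : ℂ) := by
    intro w f
    rw [← integral_complex_ofReal]
    refine integral_congr_ae (Eventually.of_forall fun x => ?_)
    simp only [Complex.conj_mul']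
    push_cast
    ring
  unfold sumForm
  rw [h, h, Complex.add_re, Complex.ofReal_re, Complex.ofReal_re]
  rfl

lemma coeFn_finsetSum {ι : Type*} (s : Finset ι) (f : ι → L2) :
    ((∑ i ∈ s, f i : L2) : R3 → ℂ) =ᵐ[volume] fun x => ∑ i ∈ s, f i x := by
  classical
  induction s using Finset.induction_on with
  | empty =>
    simp only [Finset.sum_empty]
    exact Lp.coeFn_zero _ _ _
  | insert i s hi ih =>
    rw [Finset.sum_insert hi]
    filter_upwards [ih, Lp.coeFn_add (f i) (∑ i ∈ s, f i)] with x h1 h2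
    rw [h2, Pi.add_apply, h1, Finset.sum_insert hi]

lemma coeFn_linearCombination {N : ℕ} (a : Fin N → ℂ) (f : Fin N → L2) :
    ((∑ j, a j • f j : L2) : R3 → ℂ) =ᵐ[volume] fun x => ∑ j, a j * f j x := by
  have h : ∀ᵐ x, ∀ j, (a j • f j : L2) x = a j * f j x := by
    rw [ae_all_iff]
    intro j
    filter_upwards [Lp.coeFn_smul (a j) (f j)] with x hx
    rw [hx, Pi.smul_apply, smul_eq_mul]
  filter_upwards [coeFn_finsetSum Finset.univ (fun j => a j • f j), h] with x h1 h2
  rw [h1]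
  exact Finset.sum_congr rfl fun j _ => h2 j

/-- Cauchy–Schwarz, pointwise in frequency. The lost factor `N` is harmless: it multiplies energies
that tend to zero or carry a factor `t²`. -/
lemma kineticEnergy_linearCombination_le {T : KineticSymbol} {N : ℕ} (a : Fin N → ℂ)
    {ψ : Fin N → L2} (hψ : ∀ j, ψ j ∈ kineticFormDomain T) :
    kineticEnergy T (∑ j, a j • ψ j) ≤ N * ∑ j, ‖a j‖ ^ 2 * kineticEnergy T (ψ j) := by
  have hsum : (𝓕 (∑ j, a j • ψ j) : L2) = ∑ j, a j • (𝓕 (ψ j) : L2) := by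
    have := map_sum (Lp.fourierTransformₗᵢ R3 ℂ) (fun j => a j • ψ j) Finset.univ
    simp only [map_smul] at this
    exact this
  have hmem : (∑ j, a j • ψ j) ∈ kineticFormDomain T :=
    Submodule.sum_mem _ fun j _ => Submodule.smul_mem _ _ (hψ j)
  have hint : ∀ j, Integrable (fun ξ => ‖a j‖ ^ 2 * (T.freq ξ * ‖(𝓕 (ψ j) : L2) ξ‖ ^ 2)) volume :=
    fun j => (mem_kineticFormDomain_iff.1 (hψ j)).const_mul _
  unfold kineticEnergy
  simp only [← integral_const_mul]
  rw [← integral_finsetSum _ (fun j _ => hint j), ← integral_const_mul]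
  refine integral_mono_ae (mem_kineticFormDomain_iff.1 hmem)
    ((integrable_finsetSum _ (fun j _ => hint j)).const_mul _) ?_
  rw [hsum]
  filter_upwards [coeFn_linearCombination a (fun j => (𝓕 (ψ j) : L2))] with ξ hξ
  rw [hξ]
  have h1 : ‖∑ j, a j * (𝓕 (ψ j) : L2) ξ‖ ^ 2 ≤ N * ∑ j, (‖a j‖ * ‖(𝓕 (ψ j) : L2) ξ‖) ^ 2 := by
    calc _ ≤ (∑ j, ‖a j‖ * ‖(𝓕 (ψ j) : L2) ξ‖) ^ 2 := by
          gcongr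
          refine (norm_sum_le _ _).trans_eq (Finset.sum_congr rfl fun j _ => norm_mul _ _)
      _ ≤ _ := by
          have := sq_sum_le_card_mul_sum_sq (s := Finset.univ)
            (f := fun j : Fin N => ‖a j‖ * ‖(𝓕 (ψ j) : L2) ξ‖)
          simpa using this
  calc _ ≤ T.freq ξ * (N * ∑ j, (‖a j‖ * ‖(𝓕 (ψ j) : L2) ξ‖) ^ 2) := by
        gcongr; exact T.freq_nonneg ξ
    _ = _ := by
        simp only [Finset.mul_sum]
        exact Finset.sum_congr rfl fun j _ => by ring

/-! ### Trial states -/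

/-- If `T⁻¹` is not integrable near `ω`, there are densities concentrating at `ω` with arbitrarily
small kinetic energy. -/
lemma exists_density {T : KineticSymbol} {ω : R3} {δ ε : ℝ} (hε : 0 < ε)
    (hdiv : ∫⁻ ξ in Metric.ball ω δ, (ENNReal.ofReal (T.freq ξ))⁻¹ = ⊤) :
    ∃ h : R3 → ℝ, Integrable h ∧ MemLp h 2 volume ∧ (∀ ξ, 0 ≤ h ξ) ∧ ∫ ξ, h ξ = 1 ∧
      (∀ ξ, h ξ ≠ 0 → ‖ξ - ω‖ ≤ δ) ∧ Integrable (fun ξ => T.freq ξ * h ξ ^ 2) ∧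
      ∫ ξ, T.freq ξ * h ξ ^ 2 ≤ ε := by
  set U := Metric.ball ω δ with hU
  have hUm : MeasurableSet U := measurableSet_ball
  -- The regularised weights `(T + κ)⁻¹` are bounded, and as `κ` decreases to `0` their integrals
  -- over the ball grow to infinity, so one of them exceeds `ε⁻¹`.
  have hlim : Tendsto (fun n : ℕ => ∫⁻ ξ in U, (ENNReal.ofReal (T.freq ξ + 1 / ((n : ℝ) + 1)))⁻¹)
      atTop (𝓝 ⊤) := by
    rw [← hdiv]
    refine lintegral_tendsto_of_tendsto_of_monotone (fun n => ?_) (Eventually.of_forall fun ξ => ?_)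
      (Eventually.of_forall fun ξ => ?_)
    · have := T.measurable_freq
      fun_prop
    · intro m n hmn
      have : 1 / ((n : ℝ) + 1) ≤ 1 / ((m : ℝ) + 1) := Nat.one_div_le_one_div hmn
      simp only
      gcongr
    · refine tendsto_inv_iff.2 (ENNReal.tendsto_ofReal ?_)
      simpa using tendsto_one_div_add_atTop_nhds_zero_nat.const_add (T.freq ξ)
  obtain ⟨n, hn⟩ := (hlim.eventually (lt_mem_nhds (ENNReal.ofReal_lt_top (r := ε⁻¹)))).exists
  set κ : ℝ := 1 / ((n : ℝ) + 1) with hκ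
  have hκ0 : 0 < κ := by positivity
  set k : R3 → ℝ := U.indicator fun ξ => (T.freq ξ + κ)⁻¹ with hk
  have hpos : ∀ ξ, 0 < T.freq ξ + κ := fun ξ => add_pos_of_nonneg_of_pos (T.freq_nonneg ξ) hκ0
  have hk0 : ∀ ξ, 0 ≤ k ξ := fun ξ => Set.indicator_nonneg (fun ξ _ => (inv_pos.2 (hpos ξ)).le) ξ
  have hkm : Measurable k := by
    refine Measurable.indicator ?_ hUm
    have := T.measurable_freq
    fun_prop
  have hkb : ∀ ξ, ‖k ξ‖ ≤ U.indicator (fun _ => κ⁻¹) ξ := by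
    intro ξ
    rw [Real.norm_of_nonneg (hk0 ξ)]
    refine Set.indicator_le_indicator ?_
    have := T.freq_nonneg ξ
    gcongr
    linarith
  have hUfin : volume U ≠ ⊤ := measure_ball_lt_top.ne
  have hki : Integrable k :=
    ((integrable_indicator_iff hUm).2 (integrableOn_const hUfin)).mono'
      hkm.aestronglyMeasurable (Eventually.of_forall hkb)
  have hk2 : MemLp k 2 volume := by
    refine MemLp.mono (memLp_indicator_const 2 hUm κ⁻¹ (Or.inr hUfin))
      hkm.aestronglyMeasurable (Eventually.of_forall fun ξ => (hkb ξ).trans (le_abs_self _))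
  set M : ℝ := ∫ ξ, k ξ with hM
  have hMε : ε⁻¹ < M := by
    have e : ENNReal.ofReal M = ∫⁻ ξ in U, (ENNReal.ofReal (T.freq ξ + κ))⁻¹ := by
      rw [hM, ofReal_integral_eq_lintegral_ofReal hki (Eventually.of_forall hk0),
        ← lintegral_indicator hUm]
      refine lintegral_congr fun ξ => ?_
      by_cases hξ : ξ ∈ U
      · simp only [hk, Set.indicator_of_mem hξ, ENNReal.ofReal_inv_of_pos (hpos ξ)]
      · simp only [hk, Set.indicator_of_notMem hξ, ENNReal.ofReal_zero]
    rw [← e] at hn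
    exact (ENNReal.ofReal_lt_ofReal_iff_of_nonneg (by positivity)).1 hn
  have hM0 : 0 < M := (inv_pos.2 hε).trans hMε
  -- Since `T k² ≤ k`, the normalised density has energy at most `M⁻² ∫ k = M⁻¹ < ε`.
  have hTk : ∀ ξ, T.freq ξ * (M⁻¹ * k ξ) ^ 2 ≤ M⁻¹ ^ 2 * k ξ := by
    intro ξ
    have h1 : T.freq ξ * k ξ ^ 2 ≤ k ξ := by
      by_cases hξ : ξ ∈ U
      · simp only [hk, Set.indicator_of_mem hξ]
        have h2 : (T.freq ξ + κ) * (T.freq ξ + κ)⁻¹ = 1 := mul_inv_cancel₀ (hpos ξ).ne'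
        have h3 : 0 < (T.freq ξ + κ)⁻¹ := inv_pos.2 (hpos ξ)
        have h4 : T.freq ξ * (T.freq ξ + κ)⁻¹ ≤ 1 := by nlinarith
        nlinarith
      · simp [hk, Set.indicator_of_notMem hξ]
    calc _ = M⁻¹ ^ 2 * (T.freq ξ * k ξ ^ 2) := by ring
      _ ≤ _ := mul_le_mul_of_nonneg_left h1 (sq_nonneg _)
  have hTi : Integrable (fun ξ => T.freq ξ * (M⁻¹ * k ξ) ^ 2) := by
    refine (hki.const_mul (M⁻¹ ^ 2)).mono'
      (T.measurable_freq.mul ((hkm.const_mul _).pow_const 2)).aestronglyMeasurable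
      (Eventually.of_forall fun ξ => ?_)
    rw [Real.norm_of_nonneg (mul_nonneg (T.freq_nonneg ξ) (sq_nonneg _))]
    exact hTk ξ
  refine ⟨fun ξ => M⁻¹ * k ξ, hki.const_mul _, hk2.const_mul _,
    fun ξ => mul_nonneg (inv_pos.2 hM0).le (hk0 ξ), ?_, fun ξ hξ => ?_, hTi, ?_⟩
  · rw [integral_const_mul, inv_mul_cancel₀ hM0.ne']
  · by_contra hcon
    have hξU : ξ ∉ U := by
      rw [hU, Metric.mem_ball, dist_eq_norm]
      intro hlt
      exact hcon hlt.le
    refine hξ ?_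
    change M⁻¹ * U.indicator _ ξ = 0
    rw [Set.indicator_of_notMem hξU, mul_zero]
  · calc _ ≤ ∫ ξ, M⁻¹ ^ 2 * k ξ := integral_mono hTi (hki.const_mul _) hTk
      _ = M⁻¹ := by rw [integral_const_mul, ← hM, sq, mul_assoc, inv_mul_cancel₀ hM0.ne', mul_one]
      _ ≤ ε := (inv_lt_of_inv_lt₀ hε hMε).le

/-- If `T⁻¹` is not integrable near `ω`, there are trial states of vanishing kinetic energy
converging to the plane wave of frequency `ω`. -/
lemma exists_trialState {T : KineticSymbol} {ω : R3}
    (hdiv : ∀ δ > 0, ∫⁻ ξ in Metric.ball ω δ, (ENNReal.ofReal (T.freq ξ))⁻¹ = ⊤) :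
    ∃ φ : ℕ → L2, (∀ n, φ n ∈ kineticFormDomain T) ∧
      Tendsto (fun n => kineticEnergy T (φ n)) atTop (𝓝 0) ∧
      ∀ᵐ x, (∀ n, ‖φ n x‖ ≤ 1) ∧
        Tendsto (fun n => φ n x) atTop (𝓝 (Real.fourierChar ⟪ω, x⟫_ℝ : ℂ)) := by
  have hε : ∀ n : ℕ, (0 : ℝ) < 1 / ((n : ℝ) + 1) := fun n => by positivity
  -- The number `1 / (n + 1)` serves both as concentration radius and as energy bound.
  choose h hi h2 h0 h1 hs hTi hT using fun n : ℕ => exists_density (hε n) (hdiv _ (hε n))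
  have h2' : ∀ n, MemLp (fun ξ => (h n ξ : ℂ)) 2 volume := fun n => (h2 n).ofReal
  have hi' : ∀ n, Integrable (fun ξ => (h n ξ : ℂ)) volume := fun n => (hi n).ofReal
  have hF : ∀ n, (𝓕 (𝓕⁻ ((h2' n).toLp _ : L2) : L2) : L2) =ᵐ[volume] fun ξ => (h n ξ : ℂ) := by
    intro n
    rw [FourierTransform.fourier_fourierInv_eq]
    exact (h2' n).coeFn_toLp
  have hFT : ∀ n, (fun ξ => T.freq ξ * ‖(𝓕 (𝓕⁻ ((h2' n).toLp _ : L2) : L2) : L2) ξ‖ ^ 2) =ᵐ[volume]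
      fun ξ => T.freq ξ * h n ξ ^ 2 := by
    intro n
    filter_upwards [hF n] with ξ hξ
    rw [hξ, Complex.norm_real, Real.norm_eq_abs, sq_abs]
  refine ⟨fun n => 𝓕⁻ ((h2' n).toLp _ : L2), fun n => ?_, ?_, ?_⟩
  · exact mem_kineticFormDomain_iff.2 ((hTi n).congr (hFT n).symm)
  · refine squeeze_zero (fun n => kineticEnergy_nonneg T _) (fun n => ?_)
      tendsto_one_div_add_atTop_nhds_zero_nat
    exact (integral_congr_ae (hFT n)).trans_le (hT n)
  · have hall := ae_all_iff.2 fun n => fourierInv_toLp_ae_eq (hi' n) (h2' n)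
    filter_upwards [hall] with x hx
    refine ⟨fun n => ?_, ?_⟩
    · rw [hx n]
      exact norm_fourierInv_le_one (h0 n) (h1 n) x
    · rw [tendsto_iff_norm_sub_tendsto_zero]
      refine squeeze_zero (fun n => norm_nonneg _) (fun n => ?_)
        (g := fun n : ℕ => 2 * Real.pi * (1 / ((n : ℝ) + 1)) * ‖x‖) ?_
      · rw [hx n]
        exact norm_fourierInv_sub_le (hi n) (h0 n) (h1 n) (hs n) x
      · simpa using
          (tendsto_one_div_add_atTop_nhds_zero_nat.const_mul (2 * Real.pi)).mul_const ‖x‖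

end PairOperator

end FourierInversion

/-! ### Divergence of the inverse symbol along the zero segment. -/

section Divergence

open Filter Topology

namespace PairOperator

/-- If `f` vanishes quadratically along a segment in `ℝ³`, then `f⁻¹` is not integrable near it. -/
lemma lintegral_inv_eq_top_of_le_sq (b : OrthonormalBasis (Fin 3) ℝ R3) {f : R3 → ℝ} {U : Set R3}
    {α β ρ K : ℝ} (hαβ : α < β) (hρ : 0 < ρ) (hK : 0 < K)
    (hU : ∀ ξ, b.repr ξ 0 ∈ Set.Ioo α β → b.repr ξ 1 ∈ Set.Ioc 0 ρ → b.repr ξ 2 ∈ Set.Ioc 0 ρ →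
      ξ ∈ U ∧ f ξ ≤ K * (b.repr ξ 1 ^ 2 + b.repr ξ 2 ^ 2)) :
    ∫⁻ ξ in U, (ENNReal.ofReal (f ξ))⁻¹ = ⊤ := by
  let e : R3 → Fin 3 → ℝ := fun ξ => (b.repr ξ).ofLp
  have he : MeasurePreserving e volume volume :=
    (PiLp.volume_preserving_ofLp (Fin 3)).comp b.measurePreserving_repr
  -- Dyadic boxes, disjoint through their second coordinate. Each has volume `(β - α) r_j² / 2`
  -- while `f ≤ 2 K r_j²` on it, so all contribute at least the same positive amount `(β - α) / (4
  -- K)`.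
  let r : ℕ → ℝ := fun j => ρ * (1 / 2) ^ j
  have hr0 : ∀ j, 0 < r j := fun j => by positivity
  have hrs : ∀ j, r (j + 1) = r j / 2 := fun j => by simp only [r, pow_succ]; ring
  have hranti : Antitone r := antitone_nat_of_succ_le fun j => by rw [hrs]; linarith [hr0 j]
  have hrρ : ∀ j, r j ≤ ρ := fun j => (hranti (Nat.zero_le j)).trans_eq (by simp [r])
  let I : ℕ → Fin 3 → Set ℝ := fun j => ![Set.Ioo α β, Set.Ioc (r (j + 1)) (r j), Set.Ioc 0 (r j)]
  have hIm : ∀ j, MeasurableSet (Set.univ.pi (I j)) := fun j => by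
    refine MeasurableSet.univ_pi fun i => ?_
    fin_cases i
    exacts [measurableSet_Ioo, measurableSet_Ioc, measurableSet_Ioc]
  let box : ℕ → Set R3 := fun j => e ⁻¹' Set.univ.pi (I j)
  have hboxm : ∀ j, MeasurableSet (box j) := fun j => he.measurable (hIm j)
  have hbox : ∀ j ξ, ξ ∈ box j → b.repr ξ 0 ∈ Set.Ioo α β ∧
      b.repr ξ 1 ∈ Set.Ioc (r (j + 1)) (r j) ∧ b.repr ξ 2 ∈ Set.Ioc 0 (r j) := fun j ξ hξ =>
    ⟨hξ 0 trivial, hξ 1 trivial, hξ 2 trivial⟩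
  have hvol : ∀ j, volume (box j) = ENNReal.ofReal ((β - α) * (r j ^ 2 / 2)) := fun j => by
    rw [he.measure_preimage (hIm j).nullMeasurableSet, volume_pi_pi, Fin.prod_univ_three]
    change volume (Set.Ioo α β) * volume (Set.Ioc (r (j + 1)) (r j)) * volume (Set.Ioc 0 (r j)) = _
    have := hr0 j
    rw [Real.volume_Ioo, Real.volume_Ioc, Real.volume_Ioc, hrs,
      ← ENNReal.ofReal_mul (by linarith), ← ENNReal.ofReal_mul]
    · congr 1; ring
    · exact mul_nonneg (by linarith) (by linarith)
  have hdisj : Pairwise (Function.onFun Disjoint box) := by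
    have key : ∀ i j, i < j → Disjoint (box i) (box j) := fun i j hij => by
      rw [Set.disjoint_left]
      intro ξ h1 h2
      have h3 := (hbox i ξ h1).2.1.1
      have h4 := (hbox j ξ h2).2.1.2
      have h5 : r j ≤ r (i + 1) := hranti hij
      linarith
    intro i j hij
    rcases hij.lt_or_gt with h | h
    · exact key i j h
    · exact (key j i h).symm
  have hsub : ⋃ j, box j ⊆ U := Set.iUnion_subset fun j ξ hξ => by
    obtain ⟨h0, h1, h2⟩ := hbox j ξ hξ
    exact (hU ξ h0 ⟨(hr0 _).trans h1.1, h1.2.trans (hrρ j)⟩ ⟨h2.1, h2.2.trans (hrρ j)⟩).1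
  have hlow : ∀ j, ENNReal.ofReal ((β - α) / (4 * K)) ≤
      ∫⁻ ξ in box j, (ENNReal.ofReal (f ξ))⁻¹ := fun j => by
    have hrj := hr0 j
    calc ENNReal.ofReal ((β - α) / (4 * K))
        = (ENNReal.ofReal (2 * K * r j ^ 2))⁻¹ * volume (box j) := by
          rw [hvol, ← ENNReal.ofReal_inv_of_pos (by positivity), ← ENNReal.ofReal_mul (by positivity)]
          congr 1
          field_simp
          ring
      _ = ∫⁻ ξ in box j, (ENNReal.ofReal (2 * K * r j ^ 2))⁻¹ := (setLIntegral_const _ _).symm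
      _ ≤ _ := by
          refine setLIntegral_mono' (hboxm j) fun ξ hξ => ?_
          obtain ⟨h0, h1, h2⟩ := hbox j ξ hξ
          have h1' : 0 < b.repr ξ 1 := (hr0 _).trans h1.1
          have hf := (hU ξ h0 ⟨h1', h1.2.trans (hrρ j)⟩ ⟨h2.1, h2.2.trans (hrρ j)⟩).2
          refine ENNReal.inv_le_inv.2 (ENNReal.ofReal_le_ofReal (hf.trans ?_))
          have h3 : b.repr ξ 1 ^ 2 ≤ r j ^ 2 := pow_le_pow_left₀ h1'.le h1.2 2
          have h4 : b.repr ξ 2 ^ 2 ≤ r j ^ 2 := pow_le_pow_left₀ h2.1.le h2.2 2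
          nlinarith
  rw [eq_top_iff]
  calc ⊤ = ∑' _ : ℕ, ENNReal.ofReal ((β - α) / (4 * K)) := by
        refine (ENNReal.tsum_const_eq_top_of_ne_zero ?_).symm
        rw [Ne, ENNReal.ofReal_eq_zero, not_le]
        exact div_pos (by linarith) (by linarith)
    _ ≤ ∑' j, ∫⁻ ξ in box j, (ENNReal.ofReal (f ξ))⁻¹ := ENNReal.tsum_le_tsum hlow
    _ = ∫⁻ ξ in ⋃ j, box j, (ENNReal.ofReal (f ξ))⁻¹ := (lintegral_iUnion hboxm hdisj _).symm
    _ ≤ _ := lintegral_mono_set hsub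

lemma exists_orthonormalBasis_smul_eq {P : R3} (hP : P ≠ 0) :
    ∃ b : OrthonormalBasis (Fin 3) ℝ R3, P = ‖P‖ • b 0 := by
  have hP' : ‖P‖ ≠ 0 := norm_ne_zero_iff.2 hP
  have hv : Orthonormal ℝ (({0} : Set (Fin 3)).domRestrict fun _ => ‖P‖⁻¹ • P) := by
    refine ⟨fun i => ?_, fun i j hij => absurd (Subsingleton.elim i j) hij⟩
    rw [Set.domRestrict_apply, norm_smul, norm_inv, norm_norm, inv_mul_cancel₀ hP']
  obtain ⟨b, hb⟩ := hv.exists_orthonormalBasis_extension_of_card_eq (by simp)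
  refine ⟨b, ?_⟩
  rw [hb 0 rfl, smul_smul, mul_inv_cancel₀ hP', one_smul]

lemma norm_sq_eq_repr (b : OrthonormalBasis (Fin 3) ℝ R3) (v : R3) :
    ‖v‖ ^ 2 = b.repr v 0 ^ 2 + b.repr v 1 ^ 2 + b.repr v 2 ^ 2 := by
  rw [← b.repr.norm_map v, EuclideanSpace.real_norm_sq_eq, Fin.sum_univ_three]

/-- Tangent-line bound for the square root, a rewriting of `0 ≤ (N - A)²`. Here `A` will be the
longitudinal component of a vector and `r` its squared transversal part. -/
lemma le_add_div_of_sq_eq {N A r : ℝ} (hA : 0 < A) (h : N ^ 2 = A ^ 2 + r) :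
    N ≤ A + r / (2 * A) := by
  have h1 : 0 ≤ (N - A) ^ 2 := sq_nonneg _
  have h2 : r / (2 * A) = (N ^ 2 - A ^ 2) / (2 * A) := by rw [h]; ring
  rw [h2, ← sub_le_iff_le_add', le_div_iff₀ (by positivity)]
  nlinarith

lemma repr_of_eq_smul {b : OrthonormalBasis (Fin 3) ℝ R3} {P : R3} {p : ℝ} (hb : P = p • b 0)
    (i : Fin 3) : b.repr P i = if i = 0 then p else 0 := by
  rw [hb, map_smul, b.repr_self]
  simp

/-- The pair symbol vanishes quadratically in the directions transversal to `P`. -/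
lemma pairSymbol_freq_le {b : OrthonormalBasis (Fin 3) ℝ R3} {P : R3} (hb : P = ‖P‖ • b 0)
    {μp μm : ℝ} (hμ : μp + μm = 1) {a : ℝ} (ha : 0 < a) {ξ : R3}
    (h1 : a ≤ μp * ‖P‖ - 2 * Real.pi * b.repr ξ 0) (h2 : a ≤ μm * ‖P‖ + 2 * Real.pi * b.repr ξ 0) :
    (pairSymbol P μp μm hμ).freq ξ ≤
      (2 * Real.pi) ^ 2 / a * (b.repr ξ 1 ^ 2 + b.repr ξ 2 ^ 2) := by
  have hPr := repr_of_eq_smul hb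
  have hfreq : (pairSymbol P μp μm hμ).freq ξ =
      ‖μp • P - (2 * Real.pi) • ξ‖ + ‖μm • P + (2 * Real.pi) • ξ‖ - ‖P‖ := rfl
  have hq0 : 0 ≤ (2 * Real.pi) ^ 2 * (b.repr ξ 1 ^ 2 + b.repr ξ 2 ^ 2) := by positivity
  have n1 : ‖μp • P - (2 * Real.pi) • ξ‖ ^ 2 = (μp * ‖P‖ - 2 * Real.pi * b.repr ξ 0) ^ 2 +
      (2 * Real.pi) ^ 2 * (b.repr ξ 1 ^ 2 + b.repr ξ 2 ^ 2) := by
    rw [norm_sq_eq_repr b]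
    simp only [map_sub, map_smul, PiLp.sub_apply, PiLp.smul_apply, hPr, smul_eq_mul, if_true,
      Fin.reduceEq, one_ne_zero, if_false, mul_zero]
    ring
  have n2 : ‖μm • P + (2 * Real.pi) • ξ‖ ^ 2 = (μm * ‖P‖ + 2 * Real.pi * b.repr ξ 0) ^ 2 +
      (2 * Real.pi) ^ 2 * (b.repr ξ 1 ^ 2 + b.repr ξ 2 ^ 2) := by
    rw [norm_sq_eq_repr b]
    simp only [map_add, map_smul, PiLp.add_apply, PiLp.smul_apply, hPr, smul_eq_mul, if_true,
      Fin.reduceEq, one_ne_zero, if_false, mul_zero]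
    ring
  have m1 := le_add_div_of_sq_eq (ha.trans_le h1) n1
  have m2 := le_add_div_of_sq_eq (ha.trans_le h2) n2
  -- The longitudinal parts add up to exactly `‖P‖`, so only the quadratic transversal terms
  -- survive.
  have m6 : μp * ‖P‖ + μm * ‖P‖ = ‖P‖ := by rw [← add_mul, hμ, one_mul]
  have m5 : (2 * Real.pi) ^ 2 / a * (b.repr ξ 1 ^ 2 + b.repr ξ 2 ^ 2) =
      (2 * Real.pi) ^ 2 * (b.repr ξ 1 ^ 2 + b.repr ξ 2 ^ 2) / (2 * a) +
        (2 * Real.pi) ^ 2 * (b.repr ξ 1 ^ 2 + b.repr ξ 2 ^ 2) / (2 * a) := by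
    field_simp; ring
  rw [hfreq, m5]
  generalize (2 * Real.pi) ^ 2 * (b.repr ξ 1 ^ 2 + b.repr ξ 2 ^ 2) = q at *
  have m3 : q / (2 * (μp * ‖P‖ - 2 * Real.pi * b.repr ξ 0)) ≤ q / (2 * a) := by gcongr
  have m4 : q / (2 * (μm * ‖P‖ + 2 * Real.pi * b.repr ξ 0)) ≤ q / (2 * a) := by gcongr
  linarith

/-- The inverse of the pair symbol is not integrable near any point of the segment on which the
symbol vanishes. -/
lemma lintegral_inv_pairSymbol_eq_top {P : R3} (hP : P ≠ 0) {μp μm : ℝ} (hμ : μp + μm = 1)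
    {s : ℝ} (hs : s ∈ Set.Icc (-μm) μp) {δ : ℝ} (hδ : 0 < δ) :
    ∫⁻ ξ in Metric.ball ((s / (2 * Real.pi)) • P) δ,
      (ENNReal.ofReal ((pairSymbol P μp μm hμ).freq ξ))⁻¹ = ⊤ := by
  obtain ⟨b, hb⟩ := exists_orthonormalBasis_smul_eq hP
  obtain ⟨hs1, hs2⟩ := hs
  have hp : 0 < ‖P‖ := norm_pos_iff.2 hP
  set p := ‖P‖ with hpdef
  have hπ := Real.pi_gt_three
  obtain ⟨t, ht0, ht1, htδ⟩ : ∃ t : ℝ, 0 < t ∧ t ≤ 1 ∧ t * p ≤ δ :=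
    ⟨min 1 (δ / p), lt_min one_pos (by positivity), min_le_left _ _,
      (le_div_iff₀ hp).1 (min_le_right _ _)⟩
  -- The point `s` may be an endpoint, so it is moved towards the midpoint `(μp - μm) / 2`. As the
  -- segment has length `1`, this leaves a distance of at least `t / 2` to both ends and shifts by
  -- at most `t / 2`.
  set σ : ℝ := (1 - t) * s + t * ((μp - μm) / 2) with hσ
  have hσ1 : t / 2 ≤ σ + μm := by
    have h1 : 0 ≤ (1 - t) * (s + μm) := mul_nonneg (by linarith) (by linarith)
    have h2 : σ + μm = (1 - t) * (s + μm) + t * ((μp + μm) / 2) := by rw [hσ]; ring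
    rw [h2, hμ]; linarith
  have hσ2 : t / 2 ≤ μp - σ := by
    have h1 : 0 ≤ (1 - t) * (μp - s) := mul_nonneg (by linarith) (by linarith)
    have h2 : μp - σ = (1 - t) * (μp - s) + t * ((μp + μm) / 2) := by rw [hσ]; ring
    rw [h2, hμ]; linarith
  have hσs : |σ - s| ≤ t / 2 := by
    have h1 : σ - s = t * ((μp - μm) / 2 - s) := by rw [hσ]; ring
    have h2 : |(μp - μm) / 2 - s| ≤ 1 / 2 := by rw [abs_le]; constructor <;> linarith
    rw [h1, abs_mul, abs_of_pos ht0]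
    nlinarith
  have hPr := repr_of_eq_smul hb
  have hω : ∀ ξ i, b.repr (ξ - (s / (2 * Real.pi)) • P) i =
      b.repr ξ i - s / (2 * Real.pi) * (if i = 0 then p else 0) := fun ξ i => by
    rw [map_sub, map_smul, PiLp.sub_apply, PiLp.smul_apply, hPr, smul_eq_mul]
  -- Then `2π x` stays within `t p / 4` of `σ p`, so both longitudinal components remain at least `t
  -- p / 4`, the value entering `K`. With `ρ = δ / 3` the box lies in the ball, as `1/4 + 2/9 < 1`.
  set w : ℝ := t * p / (8 * Real.pi) with hw
  have hw0 : 0 < w := by positivity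
  refine lintegral_inv_eq_top_of_le_sq b (α := σ * p / (2 * Real.pi) - w)
    (β := σ * p / (2 * Real.pi) + w) (ρ := δ / 3) (K := (2 * Real.pi) ^ 2 / (t * p / 4))
    (by linarith) (by positivity) (by positivity) fun ξ h0 h1 h2 => ?_
  set x := b.repr ξ 0
  set y := b.repr ξ 1
  set z := b.repr ξ 2
  have hx : |x - σ * p / (2 * Real.pi)| < w := by
    rw [abs_lt]; constructor <;> linarith [h0.1, h0.2]
  have hx2 : |2 * Real.pi * x - σ * p| < t * p / 4 := by
    have e1 : 2 * Real.pi * x - σ * p = 2 * Real.pi * (x - σ * p / (2 * Real.pi)) := by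
      field_simp
    have e2 : 2 * Real.pi * w = t * p / 4 := by rw [hw]; field_simp; ring
    rw [e1, abs_mul, abs_of_pos (by positivity : 0 < 2 * Real.pi), ← e2]
    gcongr
  obtain ⟨hx3, hx4⟩ := abs_lt.1 hx2
  constructor
  · rw [Metric.mem_ball, dist_eq_norm]
    refine lt_of_pow_lt_pow_left₀ 2 hδ.le ?_
    rw [norm_sq_eq_repr b, hω, hω, hω]
    simp only [if_true, Fin.reduceEq, one_ne_zero, if_false, mul_zero, sub_zero]
    change (x - s / (2 * Real.pi) * p) ^ 2 + y ^ 2 + z ^ 2 < δ ^ 2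
    have hxs : |x - s / (2 * Real.pi) * p| ≤ δ / 2 := by
      have e1 : x - s / (2 * Real.pi) * p =
          ((2 * Real.pi * x - σ * p) + (σ - s) * p) / (2 * Real.pi) := by
        field_simp
        ring
      have h3 : |(2 * Real.pi * x - σ * p) + (σ - s) * p| ≤ δ := by
        refine (abs_add_le _ _).trans ?_
        rw [abs_mul, abs_of_pos hp]
        nlinarith
      rw [e1, abs_div, abs_of_pos (by positivity : 0 < 2 * Real.pi), div_le_iff₀ (by positivity)]
      nlinarith
    have h4 : (x - s / (2 * Real.pi) * p) ^ 2 ≤ (δ / 2) ^ 2 := sq_le_sq' (by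
      linarith [neg_abs_le (x - s / (2 * Real.pi) * p)])
      ((le_abs_self _).trans hxs)
    have h5 : y ^ 2 ≤ (δ / 3) ^ 2 := pow_le_pow_left₀ h1.1.le h1.2 2
    have h6 : z ^ 2 ≤ (δ / 3) ^ 2 := pow_le_pow_left₀ h2.1.le h2.2 2
    nlinarith [sq_pos_of_pos hδ]
  · exact pairSymbol_freq_le hb hμ (by positivity) (by nlinarith) (by nlinarith)

end PairOperator

end Divergence

/-! ### Negative values of the quadratic form. -/

section NegativeForm

open Filter Topology

namespace PairOperator

/-- Triangle inequality; `μp, μm ≥ 0` makes the terms in `P` cancel. This linear growth is what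
places Schwartz functions in the form domain. -/
lemma pairSymbol_freq_le_norm (P : R3) {μp μm : ℝ} (hμp : 0 ≤ μp) (hμm : 0 ≤ μm)
    (hμ : μp + μm = 1) (ξ : R3) :
    (pairSymbol P μp μm hμ).freq ξ ≤ 4 * Real.pi * ‖ξ‖ := by
  have hfreq : (pairSymbol P μp μm hμ).freq ξ =
      ‖μp • P - (2 * Real.pi) • ξ‖ + ‖μm • P + (2 * Real.pi) • ξ‖ - ‖P‖ := rfl
  have h1 := norm_sub_le (μp • P) ((2 * Real.pi) • ξ)
  have h2 := norm_add_le (μm • P) ((2 * Real.pi) • ξ)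
  rw [norm_smul, norm_smul, Real.norm_of_nonneg hμp,
    Real.norm_of_nonneg (by positivity : 0 ≤ 2 * Real.pi)] at h1
  rw [norm_smul, norm_smul, Real.norm_of_nonneg hμm,
    Real.norm_of_nonneg (by positivity : 0 ≤ 2 * Real.pi)] at h2
  have h3 : μp * ‖P‖ + μm * ‖P‖ = ‖P‖ := by rw [← add_mul, hμ, one_mul]
  rw [hfreq]
  linarith

lemma toLp_mem_kineticFormDomain (P : R3) {μp μm : ℝ} (hμp : 0 ≤ μp) (hμm : 0 ≤ μm)
    (hμ : μp + μm = 1) (g : SchwartzMap R3 ℂ) :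
    (g.toLp 2 : L2) ∈ kineticFormDomain (pairSymbol P μp μm hμ) := by
  set T := pairSymbol P μp μm hμ
  rw [mem_kineticFormDomain_iff, SchwartzMap.toLp_fourier_eq]
  set G : SchwartzMap R3 ℂ := 𝓕 g
  have hG : Integrable (fun ξ => T.freq ξ * ‖G ξ‖ ^ 2) volume := by
    obtain ⟨C, hC⟩ := G.decay 1 0
    refine (G.integrable.norm.const_mul (4 * Real.pi * C)).mono'
      (T.measurable_freq.mul (G.continuous.norm.measurable.pow_const 2)).aestronglyMeasurable
      (Eventually.of_forall fun ξ => ?_)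
    have h1 := hC.2 ξ
    rw [pow_one, norm_iteratedFDeriv_zero] at h1
    have h2 := pairSymbol_freq_le_norm P hμp hμm hμ ξ
    rw [Real.norm_of_nonneg (mul_nonneg (T.freq_nonneg ξ) (sq_nonneg _))]
    calc T.freq ξ * ‖G ξ‖ ^ 2 ≤ 4 * Real.pi * ‖ξ‖ * ‖G ξ‖ ^ 2 := by gcongr
      _ = 4 * Real.pi * (‖ξ‖ * ‖G ξ‖) * ‖G ξ‖ := by ring
      _ ≤ _ := by gcongr
  refine hG.congr ?_
  filter_upwards [G.coeFn_toLp 2 volume] with ξ hξ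
  rw [hξ]

lemma integrable_potential_mul {T : KineticSymbol} {V : R3 → ℝ} (hV : AEMeasurable V volume)
    (hc : RelFormCompact T V) {ψ : L2} (hψ : ψ ∈ kineticFormDomain T) :
    Integrable (fun x => V x * ‖ψ x‖ ^ 2) volume := by
  have h := (mem_weightDomain_iff hV).1 (mem_sumFormDomain hV hc hψ).2
  refine h.mono (hV.mul ((Lp.aestronglyMeasurable ψ).norm.aemeasurable.pow_const
    2)).aestronglyMeasurable (Eventually.of_forall fun x => ?_)
  simp

/-- Fatou's lemma for the negative part of the potential energy. -/
lemma lintegral_neg_potential_le {V : R3 → ℝ} (hV : AEMeasurable V volume) {ψ : ℕ → L2}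
    {u : R3 → ℂ} (hlim : ∀ᵐ x, Tendsto (fun n => ψ n x) atTop (𝓝 (u x))) {c : ℕ → ℝ} {c₀ : ℝ}
    (hc : Tendsto c atTop (𝓝 c₀))
    (h : ∀ n, ∫⁻ x, ENNReal.ofReal (-(V x * ‖ψ n x‖ ^ 2)) ≤ ENNReal.ofReal (c n)) :
    ∫⁻ x, ENNReal.ofReal (-(V x * ‖u x‖ ^ 2)) ≤ ENNReal.ofReal c₀ := by
  have h1 : ∫⁻ x, ENNReal.ofReal (-(V x * ‖u x‖ ^ 2)) =
      ∫⁻ x, liminf (fun n => ENNReal.ofReal (-(V x * ‖ψ n x‖ ^ 2))) atTop := by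
    refine lintegral_congr_ae ?_
    filter_upwards [hlim] with x hx
    exact (ENNReal.tendsto_ofReal ((hx.norm.pow 2).const_mul (V x)).neg).liminf_eq.symm
  rw [h1]
  refine (lintegral_liminf_le' fun n => ?_).trans ?_
  · exact (hV.mul ((Lp.aestronglyMeasurable (ψ n)).norm.aemeasurable.pow_const
      2)).neg.ennreal_ofReal
  · rw [← (ENNReal.tendsto_ofReal hc).liminf_eq]
    exact liminf_le_liminf (Eventually.of_forall h)

/-- If the form is nonnegative, the negative part of the potential energy is controlled. -/
lemma lintegral_neg_le_of_nonneg {T : KineticSymbol} {V : R3 → ℝ} (hV : AEMeasurable V volume)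
    (hc : RelFormCompact T V) {ψ : L2} (hψ : ψ ∈ kineticFormDomain T)
    (hQ : 0 ≤ kineticEnergy T ψ + ∫ x, V x * ‖ψ x‖ ^ 2) {v : ℝ≥0∞} (hv : v ≠ ⊤)
    (hle : ∫⁻ x, ENNReal.ofReal (V x * ‖ψ x‖ ^ 2) ≤ v) :
    ∫⁻ x, ENNReal.ofReal (-(V x * ‖ψ x‖ ^ 2)) ≤ ENNReal.ofReal (kineticEnergy T ψ + v.toReal) := by
  have hi := integrable_potential_mul hV hc hψ
  rw [integral_eq_lintegral_pos_part_sub_lintegral_neg_part hi] at hQ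
  have hfin : ∫⁻ x, ENNReal.ofReal (-(V x * ‖ψ x‖ ^ 2)) ≠ ⊤ := by
    refine ne_top_of_le_ne_top hi.2.ne (lintegral_mono fun x => ?_)
    rw [← ofReal_norm]
    exact ENNReal.ofReal_le_ofReal (neg_le_abs _)
  have h1 := ENNReal.toReal_mono hv hle
  rw [← ENNReal.ofReal_toReal hfin]
  exact ENNReal.ofReal_le_ofReal (by linarith)

/-- For small `t` of the sign opposite to `β` the linear term wins; `t = -β / (|γ| + 1)` is already
small enough. -/
lemma eq_zero_of_forall_nonneg {β γ : ℝ} (h : ∀ t : ℝ, 0 ≤ 2 * t * β + t ^ 2 * γ) : β = 0 := by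
  by_contra hβ
  set c := |γ| + 1 with hc
  have hc0 : 0 < c := by positivity
  have h1 := h (-(β / c))
  have h2 : 2 * -(β / c) * β + (-(β / c)) ^ 2 * γ = (β / c) ^ 2 * (γ - 2 * c) := by
    field_simp
    ring
  rw [h2] at h1
  have h3 : γ - 2 * c < 0 := by linarith [le_abs_self γ, abs_nonneg γ]
  have h4 : 0 < (β / c) ^ 2 := by positivity
  nlinarith

/-- A nonzero potential with nonpositive integral produces a negative form value. -/
theorem exists_sumForm_neg {P : R3} (hP : P ≠ 0) {μp μm : ℝ} (hμp : 0 ≤ μp) (hμm : 0 ≤ μm)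
    (hμ : μp + μm = 1) {V : R3 → ℝ} (hV : AEMeasurable V volume)
    (hVc : RelFormCompact (pairSymbol P μp μm hμ) V) (hV0 : ¬ V =ᵐ[volume] 0)
    (hVfin : ∫⁻ x, ENNReal.ofReal (V x) < ⊤)
    (hVint : ∫⁻ x, ENNReal.ofReal (V x) ≤ ∫⁻ x, ENNReal.ofReal (-V x)) :
    ∃ ψ ∈ kineticFormDomain (pairSymbol P μp μm hμ),
      (sumForm (pairSymbol P μp μm hμ) V ψ ψ).re < 0 := by
  by_contra! hcon
  set T := pairSymbol P μp μm hμ with hT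
  simp only [re_sumForm_self] at hcon
  -- Momentum zero lies on the segment because both weights are nonnegative; the trial states
  -- converge to the constant `1`.
  obtain ⟨φ, hφ, hkin, hφx⟩ := exists_trialState (T := T) (ω := 0) fun δ hδ => by
    have := lintegral_inv_pairSymbol_eq_top hP hμ (s := 0) ⟨by linarith, hμp⟩ hδ
    rwa [zero_div, zero_smul] at this
  have hlim : ∀ᵐ x, Tendsto (fun n => φ n x) atTop (𝓝 1) := by
    filter_upwards [hφx] with x hx
    simpa using hx.2
  have hle1 : ∀ n, ∀ᵐ x, ‖φ n x‖ ^ 2 ≤ 1 := fun n => by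
    filter_upwards [hφx] with x hx
    exact pow_le_one₀ (norm_nonneg _) (hx.1 n)
  -- The trial states are bounded by one, so their positive potential energy is at most that of the
  -- constant `1`; Fatou handles the negative part, which is not yet known to be integrable.
  have hneg : ∫⁻ x, ENNReal.ofReal (-V x) ≤ ∫⁻ x, ENNReal.ofReal (V x) := by
    have h := lintegral_neg_potential_le hV hlim
      (hkin.add_const (∫⁻ x, ENNReal.ofReal (V x)).toReal) fun n =>
        lintegral_neg_le_of_nonneg hV hVc (hφ n) (hcon _ (hφ n)) hVfin.ne <| by
          refine lintegral_mono_ae ?_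
          filter_upwards [hle1 n] with x hx
          rcases le_total 0 (V x) with h | h
          · exact ENNReal.ofReal_le_ofReal (mul_le_of_le_one_right h hx)
          · rw [ENNReal.ofReal_of_nonpos (mul_nonpos_of_nonpos_of_nonneg h (sq_nonneg _))]
            exact zero_le
    simpa [ENNReal.ofReal_toReal hVfin.ne] using h
  have hVi : Integrable V volume := by
    refine ⟨hV.aestronglyMeasurable, ?_⟩
    have h1 : ∀ x, ‖V x‖ₑ ≤ ENNReal.ofReal (V x) + ENNReal.ofReal (-V x) := fun x => by
      rw [← ofReal_norm, Real.norm_eq_abs]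
      rcases abs_cases (V x) with ⟨h, -⟩ | ⟨h, -⟩ <;> rw [h]
      exacts [le_self_add, le_add_self]
    calc ∫⁻ x, ‖V x‖ₑ ≤ ∫⁻ x, (ENNReal.ofReal (V x) + ENNReal.ofReal (-V x)) := lintegral_mono h1
      _ = (∫⁻ x, ENNReal.ofReal (V x)) + ∫⁻ x, ENNReal.ofReal (-V x) :=
          lintegral_add_left' hV.ennreal_ofReal _
      _ < ⊤ := ENNReal.add_lt_top.2 ⟨hVfin, hneg.trans_lt hVfin⟩
  have hVint0 : ∫ x, V x = 0 := by
    rw [integral_eq_lintegral_pos_part_sub_lintegral_neg_part hVi, le_antisymm hVint hneg, sub_self]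
  refine hV0 (ae_eq_zero_of_integral_contDiff_smul_eq_zero hVi.locallyIntegrable
    fun g hg hgc => ?_)
  have hg1 : HasCompactSupport (Complex.ofRealCLM ∘ g) := hgc.comp_left rfl
  have hg2 : ContDiff ℝ (↑(⊤ : ℕ∞)) (Complex.ofRealCLM ∘ g) := by fun_prop
  set G : SchwartzMap R3 ℂ := hg1.toSchwartzMap hg2 with hG
  have hGa : ∀ x, G x = (g x : ℂ) := fun x => rfl
  have hGmem := toLp_mem_kineticFormDomain P hμp hμm hμ G
  obtain ⟨C, hC⟩ := hgc.exists_bound_of_continuous hg.continuous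
  have hgm : AEStronglyMeasurable g volume := hg.continuous.aestronglyMeasurable
  have hVg : Integrable (fun x => V x * g x) volume :=
    hVi.mul_bdd hgm (Eventually.of_forall hC)
  have hVg2 : Integrable (fun x => V x * g x * g x) volume :=
    hVg.mul_bdd hgm (Eventually.of_forall hC)
  -- First variation of the limiting energy at the constant `1`: test with `φ n + t g` and let `n →
  -- ∞`. The kinetic energy of `φ n` disappears, that of `g` enters with `t²`, and `∫ V = 0` removes
  -- the constant term.
  have key : ∀ t : ℝ, 0 ≤ 2 * t * (∫ x, V x * g x) +
      t ^ 2 * (2 * kineticEnergy T (G.toLp 2) + ∫ x, V x * g x * g x) := by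
    intro t
    set a : Fin 2 → ℂ := ![1, (t : ℂ)] with ha
    set χ : ℕ → Fin 2 → L2 := fun n => ![φ n, (G.toLp 2 : L2)] with hχ
    have hχm : ∀ n j, χ n j ∈ kineticFormDomain T := fun n j => by
      fin_cases j
      exacts [hφ n, hGmem]
    have hψm : ∀ n, (∑ j, a j • χ n j) ∈ kineticFormDomain T := fun n =>
      Submodule.sum_mem _ fun j _ => Submodule.smul_mem _ _ (hχm n j)
    have hψx : ∀ᵐ x, ∀ n, (∑ j, a j • χ n j : L2) x = φ n x + t * g x := by
      rw [ae_all_iff]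
      intro n
      filter_upwards [coeFn_linearCombination a (χ n), G.coeFn_toLp 2 volume] with x h1 h2
      rw [h1, Fin.sum_univ_two]
      change 1 * φ n x + t * (G.toLp 2 : L2) x = _
      rw [h2, one_mul, hGa]
    have hpot : Tendsto (fun n => ∫ x, V x * ‖(∑ j, a j • χ n j : L2) x‖ ^ 2) atTop
        (𝓝 (∫ x, V x * (1 + t * g x) ^ 2)) := by
      refine tendsto_integral_of_dominated_convergence (fun x => ‖V x‖ * (1 + |t| * C) ^ 2)
        (fun n => (integrable_potential_mul hV hVc (hψm n)).aestronglyMeasurable)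
        (hVi.norm.mul_const _) (fun n => ?_) ?_
      · filter_upwards [hψx, hφx] with x h1 h2
        rw [h1 n, norm_mul, norm_pow, norm_norm]
        gcongr
        refine (norm_add_le _ _).trans (add_le_add (h2.1 n) ?_)
        rw [norm_mul, Complex.norm_real, Complex.norm_real, Real.norm_eq_abs]
        gcongr
        exact hC x
      · filter_upwards [hψx, hlim] with x h1 h2
        simp only [h1]
        have h3 : (1 + t * g x) ^ 2 = ‖(1 : ℂ) + t * g x‖ ^ 2 := by
          rw [← sq_abs (1 + t * g x), ← Real.norm_eq_abs, ← Complex.norm_real]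
          push_cast
          rfl
        rw [h3]
        exact ((h2.add_const _).norm.pow 2).const_mul _
    have hle : ∀ n, 0 ≤ 2 * (kineticEnergy T (φ n) + t ^ 2 * kineticEnergy T (G.toLp 2)) +
        ∫ x, V x * ‖(∑ j, a j • χ n j : L2) x‖ ^ 2 := fun n => by
      have h1 := kineticEnergy_linearCombination_le a (hχm n)
      have h2 : ((2 : ℕ) : ℝ) * ∑ j, ‖a j‖ ^ 2 * kineticEnergy T (χ n j) =
          2 * (kineticEnergy T (φ n) + t ^ 2 * kineticEnergy T (G.toLp 2)) := by
        rw [Fin.sum_univ_two]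
        simp [ha, hχ]
      have h3 := hcon _ (hψm n)
      linarith
    have hlim2 := ge_of_tendsto' (((hkin.add_const _).const_mul 2).add hpot) hle
    have hexp : ∫ x, V x * (1 + t * g x) ^ 2 =
        (∫ x, V x) + 2 * t * (∫ x, V x * g x) + t ^ 2 * ∫ x, V x * g x * g x := by
      have hadd : Integrable (fun x => V x + 2 * t * (V x * g x)) volume :=
        hVi.add (hVg.const_mul _)
      rw [← integral_const_mul, ← integral_const_mul, ← integral_add hVi (hVg.const_mul _),
        ← integral_add hadd (hVg2.const_mul _)]
      exact integral_congr_ae (Eventually.of_forall fun x => by ring)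
    rw [hexp, hVint0] at hlim2
    linarith
  have := eq_zero_of_forall_nonneg key
  rw [← this]
  exact integral_congr_ae (Eventually.of_forall fun x => by simp only [smul_eq_mul, mul_comm])

/-! ### Nonpositive potentials -/

/-- A nonempty level set of the character is contained in a translate of `ℤ`. -/
lemma countable_setOf_fourierChar_eq (z : ℂ) :
    {t : ℝ | (Real.fourierChar t : ℂ) = z}.Countable := by
  rcases Set.eq_empty_or_nonempty {t : ℝ | (Real.fourierChar t : ℂ) = z} with h | ⟨t₀, ht₀⟩
  · rw [h]; exact Set.countable_empty
  refine (Set.countable_range fun n : ℤ => t₀ + n).mono fun t ht => ?_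
  have ht' : (Real.fourierChar t : ℂ) = z := ht
  have ht₀' : (Real.fourierChar t₀ : ℂ) = z := ht₀
  have h1 : Real.fourierChar (t - t₀) = 1 := by
    rw [AddChar.map_sub_eq_div, Circle.ext (ht'.trans ht₀'.symm), div_self']
  have h2 := congrArg (fun w : Circle => (w : ℂ)) h1
  simp only [Real.fourierChar_apply, Circle.coe_one] at h2
  obtain ⟨n, hn⟩ := Complex.exp_eq_one_iff.1 h2
  refine ⟨n, ?_⟩
  have h3 : ((2 * Real.pi * (t - t₀) : ℝ) : ℂ) = ((n * (2 * Real.pi) : ℝ) : ℂ) := by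
    refine mul_right_cancel₀ Complex.I_ne_zero (hn.trans ?_)
    push_cast
    ring
  have h4 := Complex.ofReal_injective h3
  have h5 : t - t₀ = n := by
    have := Real.pi_pos
    have h6 : 2 * Real.pi * (t - t₀ - n) = 0 := by linarith
    rcases mul_eq_zero.1 h6 with h7 | h7
    · linarith
    · linarith
  change t₀ + n = t
  linarith

/-- A nontrivial combination of plane waves with equidistant collinear frequencies vanishes only on
a null set. -/
lemma ae_sum_fourierChar_ne_zero {P : R3} (hP : P ≠ 0) {N : ℕ} {a : Fin N → ℂ} (ha : a ≠ 0)
    {α κ : ℝ} (hκ : κ ≠ 0) : ∀ᵐ x : R3,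
      ∑ j : Fin N, a j * (Real.fourierChar (⟪(α + j * κ) • P, x⟫_ℝ) : ℂ) ≠ 0 := by
  -- Equal spacing makes the sum a unimodular factor times `p` evaluated at `e^{2πi κ⟨P,x⟩}`.
  -- Finitely many roots correspond to countably many values of a nonzero linear functional, hence
  -- to a null set of `x`.
  set p : Polynomial ℂ := ∑ j : Fin N, Polynomial.monomial (j : ℕ) (a j) with hp
  have hp0 : p ≠ 0 := by
    intro h
    refine ha (funext fun j => ?_)
    have h1 : p.coeff j = a j := by
      rw [hp, Polynomial.finsetSum_coeff, Finset.sum_eq_single j]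
      · rw [Polynomial.coeff_monomial, if_pos rfl]
      · intro i _ hij
        rw [Polynomial.coeff_monomial, if_neg (fun h => hij (Fin.ext h))]
      · exact fun h => absurd (Finset.mem_univ j) h
    rw [← h1, h]
    rfl
  have heval : ∀ z, p.eval z = ∑ j : Fin N, a j * z ^ (j : ℕ) := fun z => by
    rw [hp, Polynomial.eval_finsetSum]
    exact Finset.sum_congr rfl fun j _ => Polynomial.eval_monomial
  have hcount : {t : ℝ | p.eval (Real.fourierChar t : ℂ) = 0}.Countable := by
    refine (Set.Countable.biUnion (p.roots.toFinset.countable_toSet)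
      fun z _ => countable_setOf_fourierChar_eq z).mono fun t ht => ?_
    have ht' : p.eval (Real.fourierChar t : ℂ) = 0 := ht
    refine Set.mem_biUnion (x := (Real.fourierChar t : ℂ)) ?_ rfl
    rw [Finset.mem_coe, Multiset.mem_toFinset, Polynomial.mem_roots hp0]
    exact ht'
  let L : R3 →ₗ[ℝ] ℝ := κ • (innerₗ R3 P)
  have hL : Function.Surjective L := by
    refine LinearMap.surjective (fun h => ?_)
    have h1 : L P = 0 := by rw [h]; rfl
    have h2 : κ * ⟪P, P⟫_ℝ = 0 := h1
    rcases mul_eq_zero.1 h2 with h3 | h3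
    · exact hκ h3
    · exact hP (inner_self_eq_zero.1 h3)
  have hae : ∀ᵐ x : R3, L x ∈ {t : ℝ | p.eval (Real.fourierChar t : ℂ) = 0}ᶜ := by
    rw [ae_comp_linearMap_mem_iff L volume volume hL hcount.measurableSet.compl]
    exact hcount.ae_notMem volume
  filter_upwards [hae] with x hx
  have hx' : p.eval (Real.fourierChar (κ * ⟪P, x⟫_ℝ) : ℂ) ≠ 0 := hx
  have e : ∀ j : Fin N, (Real.fourierChar (⟪(α + j * κ) • P, x⟫_ℝ) : ℂ) =
      (Real.fourierChar (α * ⟪P, x⟫_ℝ) : ℂ) *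
        (Real.fourierChar (κ * ⟪P, x⟫_ℝ) : ℂ) ^ (j : ℕ) := fun j => by
    have h1 : ⟪(α + j * κ) • P, x⟫_ℝ = α * ⟪P, x⟫_ℝ + (j : ℕ) • (κ * ⟪P, x⟫_ℝ) := by
      rw [real_inner_smul_left, nsmul_eq_mul]; ring
    rw [h1, AddChar.map_add_eq_mul, AddChar.map_nsmul_eq_pow, Circle.coe_mul, Circle.coe_pow]
  have hsum : ∑ j : Fin N, a j * (Real.fourierChar (⟪(α + j * κ) • P, x⟫_ℝ) : ℂ) =
      (Real.fourierChar (α * ⟪P, x⟫_ℝ) : ℂ) * p.eval (Real.fourierChar (κ * ⟪P, x⟫_ℝ) : ℂ) := by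
    rw [heval, Finset.mul_sum]
    exact Finset.sum_congr rfl fun j _ => by rw [e]; ring
  rw [hsum]
  exact mul_ne_zero (Circle.coe_ne_zero _) hx'

lemma sumForm_smul_self_re (T : KineticSymbol) (V : R3 → ℝ) (c : ℂ) (ψ : L2) :
    (sumForm T V (c • ψ) (c • ψ)).re = ‖c‖ ^ 2 * (sumForm T V ψ ψ).re := by
  rw [re_sumForm_self, re_sumForm_self, mul_add]
  unfold kineticEnergy
  rw [← integral_const_mul, ← integral_const_mul, FourierTransform.fourier_smul]
  congr 1
  · refine integral_congr_ae ?_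
    filter_upwards [Lp.coeFn_smul c (𝓕 ψ : L2)] with x hx
    rw [hx, Pi.smul_apply, norm_smul]; ring
  · refine integral_congr_ae ?_
    filter_upwards [Lp.coeFn_smul c ψ] with x hx
    rw [hx, Pi.smul_apply, norm_smul]; ring

/-- A nonpositive nonzero potential makes the form negative on subspaces of any dimension. -/
theorem exists_sumForm_neg_of_nonpos {P : R3} (hP : P ≠ 0) {μp μm : ℝ}
    (hμ : μp + μm = 1) {V : R3 → ℝ} (hV : AEMeasurable V volume)
    (hVc : RelFormCompact (pairSymbol P μp μm hμ) V) (hV0 : ¬ V =ᵐ[volume] 0)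
    (hVle : ∀ᵐ x, V x ≤ 0) (N : ℕ) :
    ∃ ψ : Fin N → L2, (∀ j, ψ j ∈ kineticFormDomain (pairSymbol P μp μm hμ)) ∧
      ∀ a : Fin N → ℂ, a ≠ 0 →
        (sumForm (pairSymbol P μp μm hμ) V (∑ j, a j • ψ j) (∑ j, a j • ψ j)).re < 0 := by
  set T := pairSymbol P μp μm hμ with hT
  -- `N` equidistant points of the segment, which has length `μp + μm = 1`, starting at its lower
  -- end.
  have hs : ∀ j : Fin N, -μm + j * (1 / (N : ℝ)) ∈ Set.Icc (-μm) μp := fun j => by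
    have hN : (0 : ℝ) < N := by exact_mod_cast j.pos
    have h1 : (j : ℝ) * (1 / (N : ℝ)) ≤ 1 := by
      rw [mul_one_div, div_le_one hN]
      exact_mod_cast j.isLt.le
    have h2 : 0 ≤ (j : ℝ) * (1 / (N : ℝ)) := by positivity
    exact ⟨by linarith, by linarith⟩
  choose φ hφ hkin hφx using fun j : Fin N => exists_trialState (T := T) fun δ hδ =>
    lintegral_inv_pairSymbol_eq_top hP hμ (hs j) hδ
  by_contra! hcon
  -- The failing coefficients depend on `n`. Homogeneity puts them on the unit sphere, whose
  -- compactness supplies a nonzero limit `b`.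
  have hstep : ∀ n : ℕ, ∃ a : Fin N → ℂ, ‖a‖ = 1 ∧
      0 ≤ (sumForm T V (∑ j, a j • φ j n) (∑ j, a j • φ j n)).re := fun n => by
    obtain ⟨a, ha, hle⟩ := hcon (fun j => φ j n) (fun j => hφ j n)
    refine ⟨((‖a‖⁻¹ : ℝ) : ℂ) • a, ?_, ?_⟩
    · rw [norm_smul, Complex.norm_real, norm_inv, norm_norm,
        inv_mul_cancel₀ (norm_ne_zero_iff.2 ha)]
    · have e : ∑ j, (((‖a‖⁻¹ : ℝ) : ℂ) • a) j • φ j n =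
          ((‖a‖⁻¹ : ℝ) : ℂ) • ∑ j, a j • φ j n := by
        rw [Finset.smul_sum]
        exact Finset.sum_congr rfl fun j _ => by rw [Pi.smul_apply, smul_assoc]
      rw [e, sumForm_smul_self_re]
      exact mul_nonneg (sq_nonneg _) hle
  choose a ha1 ha2 using hstep
  obtain ⟨b, hb, θ, hθ, hlim⟩ := (isCompact_sphere (0 : Fin N → ℂ) 1).tendsto_subseq
    (x := a) (fun n => by simpa using ha1 n)
  have hb0 : b ≠ 0 := by
    rintro rfl
    simp at hb
  have hψm : ∀ n, (∑ j, a n j • φ j n) ∈ kineticFormDomain T := fun n =>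
    Submodule.sum_mem _ fun j _ => Submodule.smul_mem _ _ (hφ j n)
  set u : R3 → ℂ := fun x => ∑ j : Fin N, b j * (Real.fourierChar
    ⟪((-μm + j * (1 / (N : ℝ))) / (2 * Real.pi)) • P, x⟫_ℝ : ℂ) with hu
  have hux : ∀ᵐ x, Tendsto (fun n => (∑ j, a (θ n) j • φ j (θ n) : L2) x) atTop (𝓝 (u x)) := by
    have h1 : ∀ᵐ x, ∀ n, (∑ j, a (θ n) j • φ j (θ n) : L2) x =
        ∑ j, a (θ n) j * φ j (θ n) x :=
      ae_all_iff.2 fun n => coeFn_linearCombination (a (θ n)) fun j => φ j (θ n)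
    filter_upwards [h1, ae_all_iff.2 hφx] with x h2 h3
    simp only [h2]
    exact tendsto_finsetSum _ fun j _ => (tendsto_pi_nhds.1 hlim j).mul
      ((h3 j).2.comp hθ.tendsto_atTop)
  have hkin0 : Tendsto (fun n => N * ∑ j, kineticEnergy T (φ j (θ n))) atTop (𝓝 0) := by
    have h1 : Tendsto (fun n => ∑ j, kineticEnergy T (φ j (θ n))) atTop
        (𝓝 (∑ _j : Fin N, (0 : ℝ))) :=
      tendsto_finsetSum _ fun j _ => (hkin j).comp hθ.tendsto_atTop
    simpa using h1.const_mul (N : ℝ)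
  -- The positive part of `V` vanishes, so nonnegativity bounds the negative potential energy by the
  -- kinetic energy alone, which tends to zero.
  have hfatou := lintegral_neg_potential_le hV hux hkin0 fun n => by
    have hkle : kineticEnergy T (∑ j, a (θ n) j • φ j (θ n)) ≤
        N * ∑ j, kineticEnergy T (φ j (θ n)) := by
      refine (kineticEnergy_linearCombination_le (a (θ n)) fun j => hφ j (θ n)).trans ?_
      gcongr with j
      refine mul_le_of_le_one_left (kineticEnergy_nonneg T _) (pow_le_one₀ (norm_nonneg _) ?_)
      exact (norm_le_pi_norm (a (θ n)) j).trans_eq (ha1 _)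
    have hQ := ha2 (θ n)
    rw [re_sumForm_self] at hQ
    refine (lintegral_neg_le_of_nonneg hV hVc (hψm (θ n)) hQ ENNReal.zero_ne_top ?_).trans ?_
    · refine (lintegral_eq_zero_of_ae_eq_zero ?_).le
      filter_upwards [hVle] with x hx
      exact ENNReal.ofReal_of_nonpos (mul_nonpos_of_nonpos_of_nonneg hx (sq_nonneg _))
    · refine ENNReal.ofReal_le_ofReal ?_
      simpa using hkle
  have hzero : ∀ᵐ x, ENNReal.ofReal (-(V x * ‖u x‖ ^ 2)) = 0 := by
    rw [ENNReal.ofReal_zero, nonpos_iff_eq_zero, lintegral_eq_zero_iff'] at hfatou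
    · exact hfatou
    · have hum : Measurable u := by fun_prop
      exact (hV.mul (hum.norm.pow_const 2).aemeasurable).neg.ennreal_ofReal
  have hune : ∀ᵐ x, u x ≠ 0 := by
    have hN : N ≠ 0 := by
      rintro rfl
      exact hb0 (Subsingleton.elim _ _)
    have hκ : 1 / (N : ℝ) / (2 * Real.pi) ≠ 0 := by positivity
    filter_upwards [ae_sum_fourierChar_ne_zero hP hb0 (α := -μm / (2 * Real.pi)) hκ] with x hx
    have e : ∀ j : Fin N, (-μm + j * (1 / (N : ℝ))) / (2 * Real.pi) =
        -μm / (2 * Real.pi) + j * (1 / (N : ℝ) / (2 * Real.pi)) := fun j => by ring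
    simpa only [hu, e] using hx
  refine hV0 ?_
  filter_upwards [hzero, hune, hVle] with x h1 h2 h3
  rw [ENNReal.ofReal_eq_zero] at h1
  have h4 : 0 < ‖u x‖ ^ 2 := by positivity
  exact le_antisymm h3 (by by_contra! h5; nlinarith [mul_neg_of_neg_of_pos h5 h4])

end PairOperator

end NegativeForm

theorem theorem3p8
    (P : PairOperator.R3) (hP : P ≠ 0)
    (μp μm : ℝ) (hμp : 0 ≤ μp) (hμm : 0 ≤ μm) (hμ : μp + μm = 1)
    (V : PairOperator.R3 → ℝ) (hV : AEMeasurable V MeasureTheory.volume)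
    (hVc : PairOperator.RelFormCompact (PairOperator.pairSymbol P μp μm hμ) V)
    (hV0 : ¬ V =ᵐ[MeasureTheory.volume] 0)
    -- `∫ V dx` exists as an element of `[-∞, ∞)` and is at most `0`
    (hVfin : ∫⁻ x, ENNReal.ofReal (V x) < ⊤)
    (hVint : ∫⁻ x, ENNReal.ofReal (V x) ≤ ∫⁻ x, ENNReal.ofReal (-V x)) :
    (∃ E : ℝ, E < 0 ∧
      PairOperator.IsEigenvalue
        (PairOperator.formSum (PairOperator.pairSymbol P μp μm hμ) V hV) E) ∧
    ((∀ᵐ x, V x ≤ 0) →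
      {E : ℝ | E < 0 ∧
        PairOperator.IsEigenvalue
          (PairOperator.formSum (PairOperator.pairSymbol P μp μm hμ) V hV) E}.Infinite) := by
  refine ⟨?_, fun hVle => ?_⟩
  · obtain ⟨ψ, hψ, hneg⟩ :=
      PairOperator.exists_sumForm_neg hP hμp hμm hμ hV hVc hV0 hVfin hVint
    exact PairOperator.exists_isEigenvalue_of_sumForm_neg hV hVc hψ hneg
  · exact PairOperator.infinite_isEigenvalue_of_sumForm_neg hV hVc
      (PairOperator.exists_sumForm_neg_of_nonpos hP hμ hV hVc hV0 hVle)
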